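/- **Setting.** Let $(\mathbf X_n)_{n\ge1}$ be spatial point processes (almost surely locally finite random subsets of $\mathbb R^d$) on one probability space, observed in windows $W_n\subset\mathbb R^d$, let $\theta_n$ be real numbers, and put $\tau_n=\theta_n|W_n|$, $N_n=\#(\mathbf X_n\cap W_n)$, $\mu_n=\mathbb E N_n$. Given covariates $z_1,\dots,z_p:\mathbb R^d\to\mathbb R$ and $I\subseteq\{1,\dots,p\}$, let $p_l=|I|+1$ and $\mathbf z(u)=[1,\{z_j(u)\}_{j\in I}]\in\mathbb R^{p_l}$. For $\beta\in\mathbb R^{p_l}$ let $\rho_n(u;\beta)=\theta_n\exp\{\beta^\top\mathbf z(u)\}$ and $$p_n(\mathbf X_n;\beta)=\Big\{\prod_{u\in\mathbf X_n\cap W_n}\rho_n(u;\beta)\Big\}\exp\Big\{|W_n|-\int_{W_n}\rho_n(u;\beta)\,du\Big\},\qquad \ell_n(\beta)=\sum_{u\in\mathbf X_n\cap W_n}\beta^\top\mathbf z(u)-\theta_n\int_{W_n}e^{\beta^\top\mathbf z(u)}\,du,$$ $$e_n(\beta)=\nabla\ell_n(\beta)=\sum_{u\in\mathbf X_n\cap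 W_n}\mathbf z(u)-\theta_n\int_{W_n}\mathbf z(u)e^{\beta^\top\mathbf z(u)}\,du,\qquad \mathbf S_n(\beta)=\theta_n\int_{W_n}\mathbf z(u)\mathbf z(u)^\top e^{\beta^\top\mathbf z(u)}\,du ,$$ so that $\log p_n(\mathbf X_n;\beta)=\ell_n(\beta)+|W_n|+N_n\log\theta_n$ when $\theta_n>0$. Let $\beta_n^*$ (for large $n$) be a maximizer of $\beta\mapsto\mathbb E\,\ell_n(\beta)$, let $\hat\beta_n$ be a maximizer of $\ell_n$ whenever one exists (and arbitrary otherwise), let $p(\cdot\mid\mathcal M_l)$ be a prior probability density on $\mathbb R^{p_l}$, and let $$p_n(\mathbf X_n\mid\mathcal M_l)=\int_{\mathbb R^{p_l}}p_n(\mathbf X_n;\beta)\,p(\beta\mid\mathcal M_l)\,d\beta,\qquad L_n=\int_{\mathbb R^{p_l}}e^{\ell_n(\beta)}\,p(\beta\mid\mathcal M_l)\,d\beta .$$ **Assumptions.** - (C1′) $\beta_n^*\to\beta^*$ for some $\beta^*\in\mathbb R^{p_l}$. - (C2) $\mathbf z$ is continuous, $0<\inf_u\|\mathbf z(u)\|$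 and $\sup_u\|\mathbf z(u)\|<\infty$. - (C3) $\tau_n$ is nondecreasing, $\tau_n\to\infty$, $\liminf_n\theta_n>0$, and every $W_n$ is convex and compact. - (C4) $\tau_n^{-1}e_n(\beta_n^*)\to0$ almost surely. - (C5) $\mathbf S_n(\beta)$ is positive definite for all $n$ and $\beta$; and there are $c,\kappa>0$ such that, for all large $n$ and every $\phi\in\mathbb R^{p_l}$ with $\|\phi\|=1$, there is a Borel set $B\subseteq W_n$ with $|B|\ge\kappa|W_n|$ and $|\phi^\top\mathbf z(u)|\ge c$ for all $u\in B$. - (C8) $p(\cdot\mid\mathcal M_l)$ is continuously differentiable on $\mathbb R^{p_l}$, and $p(\beta^*\mid\mathcal M_l)>0$. - (C9) $\mu_n\asymp\tau_n$, i.e. $\mu_n=\mathcal O(\tau_n)$ and $\tau_n=\mathcal O(\mu_n)$. **Conclusion.** Almost surely, $\hat\beta_n$ is the unique maximizer of $\ell_n$ for all large $n$ and, as $n\to\infty$, $$\log L_n=\ell_n(\hat\beta_n)-\frac{p_l}2\log\mu_n+\frac{p_l}2\log(2\pi)-\frac12\log\det\{\mu_n^{-1}\mathbf S_n(\hat\beta_n)\}+\log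 p(\hat\beta_n\mid\mathcal M_l)+\mathcal O(\mu_n^{-1/2}),$$ and $\log p_n(\mathbf X_n\mid\mathcal M_l)$ equals the same right-hand side plus the term $|W_n|+N_n\log\theta_n$, which depends neither on $\beta$ nor on the model. -/

import Mathlib

open MeasureTheory Filter Topology Asymptotics

noncomputable section

namespace PointProcessBIC

/-- Euclidean space `ℝ^d`, in which the points live. -/
abbrev Space (d : ℕ) : Type := EuclideanSpace ℝ (Fin d)

/-- The parameter space `ℝ^{p_l}` of the model given by the subset `I` of the `p` covariates:
one coordinate for the intercept (`none`) and one for each covariate in `I`. -/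
abbrev Param {p : ℕ} (I : Finset (Fin p)) : Type := EuclideanSpace ℝ (Option I)

/-- A spatial point process on `ℝ^d` under `P`: a random subset of `ℝ^d` that is almost surely
locally finite and whose counts in bounded Borel sets are random variables. -/
structure IsPointProcess {Ω : Type*} [MeasurableSpace Ω] {d : ℕ} (P : Measure Ω)
    (X : Ω → Set (Space d)) : Prop where
  locallyFinite : ∀ᵐ ω ∂P, ∀ B : Set (Space d), Bornology.IsBounded B → (X ω ∩ B).Finite
  measurable_count : ∀ B : Set (Space d), MeasurableSet B → Bornology.IsBounded B →
    Measurable fun ω => (X ω ∩ B).encard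

/-- The vector `z_l(u) = [1, {z_j(u)}_{j ∈ I}]`. -/
def covVec {d p : ℕ} (z : Fin p → Space d → ℝ) (I : Finset (Fin p)) (u : Space d) : Param I :=
  WithLp.toLp 2 fun i : Option I => i.elim 1 fun j => z j u

variable {d p : ℕ} {I : Finset (Fin p)}

/-- The log-linear intensity `ρ(u; β) = θ exp(βᵀ z_l(u))`. -/
def rho (θ : ℝ) (zl : Space d → Param I) (β : Param I) (u : Space d) : ℝ :=
  θ * Real.exp (inner ℝ β (zl u))

/-- The density (with respect to the unit rate Poisson process on `W`) of the Poisson process on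
`W` with intensity `ρ(·; β)`, at the part in `W` of the configuration `x`. -/
def poissonDensity (θ : ℝ) (W : Set (Space d)) (zl : Space d → Param I) (x : Set (Space d))
    (β : Param I) : ℝ :=
  (∏ᶠ u ∈ x ∩ W, rho θ zl β u) * Real.exp (volume.real W - ∫ u in W, rho θ zl β u)

/-- The Poisson log-likelihood `ℓ(β)` (without the terms of `log poissonDensity` that do not
depend on `β`). -/
def logLik (θ : ℝ) (W : Set (Space d)) (zl : Space d → Param I) (x : Set (Space d))
    (β : Param I) : ℝ :=
  (∑ᶠ u ∈ x ∩ W, inner ℝ β (zl u)) - θ * ∫ u in W, Real.exp (inner ℝ β (zl u))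

/-- The score `e(β)`, the gradient of `ℓ` at `β`. -/
def score (θ : ℝ) (W : Set (Space d)) (zl : Space d → Param I) (x : Set (Space d))
    (β : Param I) : Param I :=
  (∑ᶠ u ∈ x ∩ W, zl u) - θ • ∫ u in W, Real.exp (inner ℝ β (zl u)) • zl u

/-- The sensitivity matrix `S(β)`, minus the (deterministic) Hessian of `ℓ` at `β`. -/
def sensitivity (θ : ℝ) (W : Set (Space d)) (zl : Space d → Param I) (β : Param I) :
    Matrix (Option I) (Option I) ℝ :=
  Matrix.of fun i j => θ * ∫ u in W, zl u i * zl u j * Real.exp (inner ℝ β (zl u))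

/-- `b` is a point of global maximum of `f`. -/
def IsArgmax {E : Type*} (f : E → ℝ) (b : E) : Prop := ∀ b', f b' ≤ f b

/-- The marginal density `p(x | M_l) = ∫ p(x; β) π(β) dβ` of the data under the prior `π`. -/
def marginalDensity (θ : ℝ) (W : Set (Space d)) (zl : Space d → Param I) (prior : Param I → ℝ)
    (x : Set (Space d)) : ℝ :=
  ∫ β : Param I, poissonDensity θ W zl x β * prior β

/-- The marginal density when the factors of the Poisson density that do not depend on `β` are
left out, that is, when `p(x; β)` stands for `exp (ℓ(β))`. -/
def marginalLik (θ : ℝ) (W : Set (Space d)) (zl : Space d → Param I) (prior : Param I → ℝ)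
    (x : Set (Space d)) : ℝ :=
  ∫ β : Param I, Real.exp (logLik θ W zl x β) * prior β

/-- The expected number of points in `W`. -/
def meanCount {Ω : Type*} [MeasurableSpace Ω] (P : Measure Ω) (X : Ω → Set (Space d))
    (W : Set (Space d)) : ℝ :=
  ∫ ω, ((X ω ∩ W).ncard : ℝ) ∂P

/-- The terms of the Laplace expansion, at the parameter value `b`:
`ℓ(b) - (p_l/2) log μ + (p_l/2) log 2π - (1/2) log det (μ⁻¹ S(b)) + log π(b)`. -/
def laplaceTerms (θ : ℝ) (W : Set (Space d)) (zl : Space d → Param I) (prior : Param I → ℝ)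
    (μ : ℝ) (x : Set (Space d)) (b : Param I) : ℝ :=
  logLik θ W zl x b - ((I.card : ℝ) + 1) / 2 * Real.log μ
    + ((I.card : ℝ) + 1) / 2 * Real.log (2 * Real.pi)
    - 1 / 2 * Real.log (μ⁻¹ • sensitivity θ W zl b).det
    + Real.log (prior b)

end PointProcessBIC

end

/-!
Write `ν` for `θ` times Lebesgue measure on `W`, so that `ν` has total mass `τ`. Put
`expRem t = eᵗ - 1 - t`. The log-likelihood satisfies exactly
`ℓ(b + h) = ℓ(b) + ⟪h, e(b)⟫ - ∫ exp ⟪b, z⟫ * expRem ⟪h, z⟫ ∂ν`.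
On the sets of condition (C5), `|⟪h, z⟫| ≥ c ‖h‖`, so for bounded `b` the last integral is at least
`τ` times a constant times `min (‖h‖²) ‖h‖`. This concavity, quadratic near `0` and linear beyond,
does not degenerate as `n` grows. At `b = βstar n`, where `e(b) = o(τ)`, it forces a maximizer to
exist, to be unique and to lie at distance `o(1)` from `βstar n`.

At the maximizer the linear term vanishes, and the Laplace integral becomes
`∫ exp (-D h) * prior (b + h) dh` with a phase `D` of size `τ`. The same lower bound controls its
tails, and near `0` the phase differs from half the quadratic form of `S(b)` by `O(τ ‖h‖³)` and the
prior from `prior b` by `O(‖h‖)`. Rescaling by `√τ` turns both into relative errors `O(τ^(-1/2))`.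
-/

namespace PointProcessBIC

section Scalar

/-- The remainder `eᵗ - 1 - t` of the first order Taylor expansion of the exponential. -/
noncomputable def expRem (t : ℝ) : ℝ := Real.exp t - 1 - t

/-- A function of the Huber type: `r ^ 2` for `r ≤ 1` and `r` for larger `r`. It is meant for
`r ≥ 0`, where it measures the growth of a convex function that is locally quadratic. -/
noncomputable def huber (r : ℝ) : ℝ := r * min 1 r

lemma huber_of_le_one {r : ℝ} (hr : r ≤ 1) : huber r = r ^ 2 := by
  rw [huber, min_eq_right hr, sq]

lemma huber_of_one_le {r : ℝ} (hr : 1 ≤ r) : huber r = r := by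
  rw [huber, min_eq_left hr, mul_one]

lemma huber_nonneg {r : ℝ} (hr : 0 ≤ r) : 0 ≤ huber r :=
  mul_nonneg hr (le_min zero_le_one hr)

lemma huber_le_self {r : ℝ} (hr : 0 ≤ r) : huber r ≤ r :=
  mul_le_of_le_one_right hr (min_le_left _ _)

lemma huber_le_sq {r : ℝ} (hr : 0 ≤ r) : huber r ≤ r ^ 2 := by
  rw [huber, sq]
  exact mul_le_mul_of_nonneg_left (min_le_right _ _) hr

lemma huber_pos {r : ℝ} (hr : 0 < r) : 0 < huber r :=
  mul_pos hr (lt_min one_pos hr)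

lemma huber_mul_huber_le {r s : ℝ} (hr : 0 ≤ r) (hs : 0 ≤ s) :
    huber r * huber s ≤ huber (r * s) := by
  have hmin : min 1 r * min 1 s ≤ min 1 (r * s) :=
    le_min (mul_le_one₀ (min_le_left _ _) (le_min zero_le_one hs) (min_le_left _ _))
      (mul_le_mul (min_le_right _ _) (min_le_right _ _) (le_min zero_le_one hs) hr)
  calc huber r * huber s = r * s * (min 1 r * min 1 s) := by unfold huber; ring
    _ ≤ huber (r * s) := mul_le_mul_of_nonneg_left hmin (mul_nonneg hr hs)

lemma continuous_expRem : Continuous expRem := by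
  unfold expRem; fun_prop

lemma expRem_nonneg (t : ℝ) : 0 ≤ expRem t := by
  unfold expRem; linarith [Real.add_one_le_exp t]

lemma huber_div_four_le_expRem {x t : ℝ} (hx : 0 ≤ x) (hxt : x ≤ |t|) :
    huber x / 4 ≤ expRem t := by
  unfold expRem
  rcases le_total (-2) t with ht | ht
  · -- `eᵗ = (e^{t/2})² ≥ (1 + t/2)²`
    have hsq : (1 + t / 2) ^ 2 ≤ Real.exp t := by
      rw [← add_halves t, Real.exp_add, ← sq, add_halves]
      exact pow_le_pow_left₀ (by linarith) (by linarith [Real.add_one_le_exp (t / 2)]) 2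
    have hxt2 : x ^ 2 ≤ t ^ 2 := by rw [← sq_abs t]; gcongr
    linarith [huber_le_sq hx]
  · rw [abs_of_nonpos (by linarith)] at hxt
    linarith [Real.exp_pos t, huber_le_self hx]

lemma abs_expRem_sub_le (t : ℝ) : |expRem t - t ^ 2 / 2| ≤ |t| ^ 3 * Real.exp |t| := by
  have h := Complex.norm_exp_sub_sum_le_norm_mul_exp (t : ℂ) 3
  have hcast : Complex.exp t - ∑ m ∈ Finset.range 3, (t : ℂ) ^ m / (m.factorial : ℂ)
      = ((expRem t - t ^ 2 / 2 : ℝ) : ℂ) := by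
    simp only [Finset.sum_range_succ, Finset.sum_range_zero, Nat.factorial, expRem]
    push_cast
    ring
  rwa [hcast, Complex.norm_real, Complex.norm_real] at h

lemma abs_exp_neg_sub_exp_neg_le {x y m : ℝ} (hx : m ≤ x) (hy : m ≤ y) :
    |Real.exp (-x) - Real.exp (-y)| ≤ |x - y| * Real.exp (-m) := by
  wlog h : x ≤ y generalizing x y
  · rw [abs_sub_comm, abs_sub_comm x y]
    exact this hy hx (le_of_not_ge h)
  have hfactor : Real.exp (-x) - Real.exp (-y) = Real.exp (-x) * (1 - Real.exp (-(y - x))) := by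
    rw [mul_sub, ← Real.exp_add]; ring_nf
  have hone : 1 - Real.exp (-(y - x)) ≤ y - x := by linarith [Real.add_one_le_exp (-(y - x))]
  rw [abs_of_nonneg (sub_nonneg.2 (Real.exp_le_exp.2 (by linarith))), abs_sub_comm,
    abs_of_nonneg (by linarith), hfactor, mul_comm]
  gcongr

lemma eventually_pos_and_isBigO_log_sub_log {α : Type*} {l : Filter α} {J H r : α → ℝ}
    (hH : ∀ᶠ n in l, 0 < H n) (hr : Tendsto r l (𝓝 0))
    (hJ : (fun n => J n - H n) =O[l] fun n => r n * H n) :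
    (∀ᶠ n in l, 0 < J n) ∧ (fun n => Real.log (J n) - Real.log (H n)) =O[l] r := by
  have hratio : (fun n => J n / H n - 1) =O[l] r := by
    refine (hJ.mul (isBigO_refl (fun n => (H n)⁻¹) l)).congr' ?_ ?_
    · filter_upwards [hH] with n hn
      field_simp
    · filter_upwards [hH] with n hn
      field_simp
  have hlim : Tendsto (fun n => J n / H n) l (𝓝 1) := by
    simpa using (hratio.trans_tendsto hr).add_const 1
  have hpos : ∀ᶠ n in l, 0 < J n := by
    filter_upwards [hH, hlim.eventually (lt_mem_nhds one_pos)] with n hn hquot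
    exact (div_pos_iff_of_pos_right hn).1 hquot
  have hlog := ((Real.differentiableAt_log one_ne_zero).isBigO_sub.comp_tendsto hlim).trans hratio
  refine ⟨hpos, hlog.congr' ?_ EventuallyEq.rfl⟩
  filter_upwards [hH, hpos] with n hHn hJn
  simp [Real.log_div hJn.ne' hHn.ne']

end Scalar

section Gaussian

variable {V : Type*} [NormedAddCommGroup V] [InnerProductSpace ℝ V] [FiniteDimensional ℝ V]
  [MeasurableSpace V] [BorelSpace V]

variable (V) in
/-- The `k`-th absolute moment of the unnormalized centred Gaussian `exp (-c ‖v‖²)` on `V`. -/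
noncomputable def gaussianMoment (c : ℝ) (k : ℕ) : ℝ :=
  ∫ v : V, ‖v‖ ^ k * Real.exp (-(c * ‖v‖ ^ 2))

lemma gaussianMoment_nonneg (c : ℝ) (k : ℕ) : 0 ≤ gaussianMoment V c k :=
  integral_nonneg fun v => by positivity

lemma gaussianMoment_zero_pos {c : ℝ} (hc : 0 < c) : 0 < gaussianMoment V c 0 := by
  have h := GaussianFourier.integral_rexp_neg_mul_sq_norm (V := V) hc
  simp only [neg_mul] at h
  simp only [gaussianMoment, pow_zero, one_mul, h]
  positivity

lemma integrable_exp_neg_mul_sq_norm {c : ℝ} (hc : 0 < c) :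
    Integrable fun v : V => Real.exp (-(c * ‖v‖ ^ 2)) := by
  refine Integrable.of_integral_ne_zero ?_
  simpa only [gaussianMoment, pow_zero, one_mul] using (gaussianMoment_zero_pos (V := V) hc).ne'

lemma integrable_pow_mul_exp_neg_mul_sq_norm {c : ℝ} (hc : 0 < c) (k : ℕ) :
    Integrable fun v : V => ‖v‖ ^ k * Real.exp (-(c * ‖v‖ ^ 2)) := by
  refine ((integrable_exp_neg_mul_sq_norm (V := V) (half_pos hc)).const_mul
    (k.factorial * Real.exp (1 / (2 * c)))).mono'
    (Continuous.aestronglyMeasurable (by fun_prop)) (ae_of_all _ fun v => ?_)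
  rw [Real.norm_of_nonneg (by positivity)]
  have hpow : ‖v‖ ^ k ≤ k.factorial * Real.exp ‖v‖ := by
    rw [mul_comm, ← div_le_iff₀ (by positivity)]
    exact Real.pow_div_factorial_le_exp _ (norm_nonneg v) k
  have hyoung : ‖v‖ ≤ 1 / (2 * c) + c / 2 * ‖v‖ ^ 2 := by
    have hsq : 1 / (2 * c) + c / 2 * ‖v‖ ^ 2 - ‖v‖ = (1 - c * ‖v‖) ^ 2 / (2 * c) := by
      field_simp; ring
    have : 0 ≤ (1 - c * ‖v‖) ^ 2 / (2 * c) := by positivity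
    linarith
  calc ‖v‖ ^ k * Real.exp (-(c * ‖v‖ ^ 2))
      ≤ k.factorial * Real.exp ‖v‖ * Real.exp (-(c * ‖v‖ ^ 2)) := by gcongr
    _ = k.factorial * Real.exp (‖v‖ - c * ‖v‖ ^ 2) := by
        rw [mul_assoc, ← Real.exp_add, sub_eq_add_neg]
    _ ≤ k.factorial * Real.exp (1 / (2 * c) + -(c / 2 * ‖v‖ ^ 2)) := by
        gcongr
        linarith
    _ = k.factorial * Real.exp (1 / (2 * c)) * Real.exp (-(c / 2 * ‖v‖ ^ 2)) := by
        rw [Real.exp_add, mul_assoc]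

lemma gaussianMoment_mul (c : ℝ) (k : ℕ) {t : ℝ} (ht : 0 < t) :
    gaussianMoment V (t * c) k = (√t ^ (Module.finrank ℝ V + k))⁻¹ * gaussianMoment V c k := by
  have hs : 0 < √t := Real.sqrt_pos.2 ht
  have h := Measure.integral_comp_smul (volume : Measure V)
    (fun v => ‖v‖ ^ k * Real.exp (-(c * ‖v‖ ^ 2))) √t
  rw [abs_of_pos (by positivity), smul_eq_mul] at h
  rw [gaussianMoment, gaussianMoment, pow_add, mul_inv, mul_right_comm, ← h,
    mul_comm _ (√t ^ k)⁻¹, ← integral_const_mul]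
  congr 1 with v
  rw [norm_smul, Real.norm_of_nonneg hs.le, mul_pow, mul_pow, Real.sq_sqrt ht.le, ← mul_assoc,
    inv_mul_cancel_left₀ (by positivity), mul_left_comm c, mul_assoc]

lemma integral_comp_linearMap {E : Type*} [NormedAddCommGroup E] [NormedSpace ℝ E]
    {A : V →ₗ[ℝ] V} (hA : LinearMap.det A ≠ 0) (f : V → E) :
    ∫ v, f (A v) = |LinearMap.det A|⁻¹ • ∫ v, f v := by
  have hemb : MeasurableEmbedding A :=
    (LinearMap.continuous_of_finiteDimensional A).measurableEmbedding
      (LinearMap.equivOfDetNeZero A hA).injective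
  rw [← hemb.integral_map, Measure.map_linearMap_addHaar_eq_smul_addHaar volume hA,
    integral_smul_measure, ENNReal.toReal_ofReal (abs_nonneg _), abs_inv]

open scoped MatrixOrder Matrix.Norms.L2Operator in
lemma exists_quadForm_eq_sq_norm {ι : Type*} [Fintype ι] [DecidableEq ι] {S : Matrix ι ι ℝ}
    (hS : S.PosDef) :
    ∃ A : EuclideanSpace ℝ ι →ₗ[ℝ] EuclideanSpace ℝ ι,
      S.det = LinearMap.det A ^ 2 ∧ ∀ h, h.ofLp ⬝ᵥ S.mulVec h.ofLp = ‖A h‖ ^ 2 := by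
  obtain ⟨A, rfl⟩ := CStarAlgebra.nonneg_iff_eq_star_mul_self.mp hS.posSemidef.nonneg
  rw [Matrix.star_eq_conjTranspose, Matrix.conjTranspose_eq_transpose_of_trivial]
  refine ⟨Matrix.toEuclideanLin A, ?_, fun h => ?_⟩
  · rw [LinearMap.det_toLpLin, Matrix.det_mul, Matrix.det_transpose, sq]
  · rw [← Matrix.mulVec_mulVec, Matrix.dotProduct_mulVec, Matrix.vecMul_transpose,
      EuclideanSpace.real_norm_sq_eq]
    simp only [dotProduct, Matrix.toLpLin_apply, sq]

lemma integral_exp_neg_half_quadForm {ι : Type*} [Fintype ι] [DecidableEq ι] {S : Matrix ι ι ℝ}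
    (hS : S.PosDef) :
    ∫ h : EuclideanSpace ℝ ι, Real.exp (-(h.ofLp ⬝ᵥ S.mulVec h.ofLp / 2))
      = (2 * Real.pi) ^ ((Fintype.card ι : ℝ) / 2) * (√S.det)⁻¹ := by
  obtain ⟨A, hdet, hquad⟩ := exists_quadForm_eq_sq_norm hS
  have hA : LinearMap.det A ≠ 0 := by
    intro h0
    simpa [h0, hdet] using hS.det_pos
  calc ∫ h : EuclideanSpace ℝ ι, Real.exp (-(h.ofLp ⬝ᵥ S.mulVec h.ofLp / 2))
      = ∫ h, Real.exp (-(1 / 2) * ‖A h‖ ^ 2) := by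
        congr 1 with h; rw [hquad]; ring_nf
    _ = |LinearMap.det A|⁻¹ * ∫ h : EuclideanSpace ℝ ι, Real.exp (-(1 / 2) * ‖h‖ ^ 2) :=
        integral_comp_linearMap hA fun h => Real.exp (-(1 / 2) * ‖h‖ ^ 2)
    _ = (2 * Real.pi) ^ ((Fintype.card ι : ℝ) / 2) * (√S.det)⁻¹ := by
        rw [GaussianFourier.integral_rexp_neg_mul_sq_norm (by norm_num), hdet,
          Real.sqrt_sq_eq_abs, mul_comm, finrank_euclideanSpace]
        congr 2
        ring

end Gaussian

section Laplace

/-- The hypotheses of the Laplace method with uniform constants: a phase `D` with its quadratic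
approximation `Q`, both of size `t`. The lower bound on `D` is quadratic for `‖h‖ ≤ 1`
and linear beyond, and the two agree to third order at `0`. -/
structure IsLaplacePhase {V : Type*} [NormedAddCommGroup V] (t c L C : ℝ) (D Q : V → ℝ) :
    Prop where
  continuous_phase : Continuous D
  continuous_quad : Continuous Q
  huber_le : ∀ h, t * c * huber ‖h‖ ≤ D h
  mul_sq_le : ∀ h, t * c * ‖h‖ ^ 2 ≤ Q h
  le_mul_sq : ∀ h, Q h ≤ t * L * ‖h‖ ^ 2
  abs_sub_le : ∀ h, ‖h‖ ≤ 1 → |D h - Q h| ≤ t * C * ‖h‖ ^ 3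

namespace IsLaplacePhase

section Pointwise

variable {V : Type*} [NormedAddCommGroup V] {t c L C K : ℝ} {D Q f : V → ℝ} {b : V}

lemma abs_integrand_sub_le_of_norm_le_one (h : IsLaplacePhase t c L C D Q) (hfb : 0 ≤ f b)
    {v : V} (hv : ‖v‖ ≤ 1) (hK : |f (b + v) - f b| ≤ K * ‖v‖) :
    |Real.exp (-D v) * f (b + v) - f b * Real.exp (-Q v)|
      ≤ (f b * C * t * ‖v‖ ^ 3 + K * ‖v‖) * Real.exp (-(t * c * ‖v‖ ^ 2)) := by
  have hD : t * c * ‖v‖ ^ 2 ≤ D v := huber_of_le_one hv ▸ h.huber_le v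
  have hphase : |f b * (Real.exp (-D v) - Real.exp (-Q v))|
      ≤ f b * (t * C * ‖v‖ ^ 3 * Real.exp (-(t * c * ‖v‖ ^ 2))) := by
    rw [abs_mul, abs_of_nonneg hfb]
    gcongr
    exact (abs_exp_neg_sub_exp_neg_le hD (h.mul_sq_le v)).trans
      (mul_le_mul_of_nonneg_right (h.abs_sub_le v hv) (Real.exp_pos _).le)
  have hamplitude : |Real.exp (-D v) * (f (b + v) - f b)|
      ≤ Real.exp (-(t * c * ‖v‖ ^ 2)) * (K * ‖v‖) := by
    rw [abs_mul, abs_of_pos (Real.exp_pos _)]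
    gcongr
  calc |Real.exp (-D v) * f (b + v) - f b * Real.exp (-Q v)|
      = |f b * (Real.exp (-D v) - Real.exp (-Q v)) + Real.exp (-D v) * (f (b + v) - f b)| := by
        ring_nf
    _ ≤ _ := (abs_add_le _ _).trans (add_le_add hphase hamplitude)
    _ = _ := by ring

lemma abs_integrand_sub_le_of_one_le_norm (h : IsLaplacePhase t c L C D Q) (htc : 0 ≤ t * c)
    (hf : ∀ v, 0 ≤ f v) {v : V} (hv : 1 ≤ ‖v‖) :
    |Real.exp (-D v) * f (b + v) - f b * Real.exp (-Q v)|
      ≤ f b * ‖v‖ * Real.exp (-(t * c * ‖v‖ ^ 2)) + Real.exp (-(t * c)) * f (b + v) := by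
  have hD : Real.exp (-D v) * f (b + v) ≤ Real.exp (-(t * c)) * f (b + v) := by
    refine mul_le_mul_of_nonneg_right (Real.exp_le_exp.2 (neg_le_neg ?_)) (hf _)
    calc t * c ≤ t * c * ‖v‖ := le_mul_of_one_le_right htc hv
      _ ≤ D v := huber_of_one_le hv ▸ h.huber_le v
  have hQ : f b * Real.exp (-Q v) ≤ f b * ‖v‖ * Real.exp (-(t * c * ‖v‖ ^ 2)) :=
    mul_le_mul (le_mul_of_one_le_right (hf b) hv)
      (Real.exp_le_exp.2 (neg_le_neg (h.mul_sq_le v))) (Real.exp_pos _).le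
      (mul_nonneg (hf b) (norm_nonneg v))
  have hfb := hf b
  have hfbv := hf (b + v)
  exact abs_sub_le_of_nonneg_of_le (by positivity)
    (hD.trans (le_add_of_nonneg_left (by positivity))) (by positivity)
    (hQ.trans (le_add_of_nonneg_right (by positivity)))

lemma abs_integrand_sub_le (h : IsLaplacePhase t c L C D Q) (ht : 0 ≤ t) (hc : 0 ≤ c)
    (hC : 0 ≤ C) (hK : 0 ≤ K) (hf : ∀ v, 0 ≤ f v)
    (hfK : ∀ v, ‖v‖ ≤ 1 → |f (b + v) - f b| ≤ K * ‖v‖) (v : V) :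
    |Real.exp (-D v) * f (b + v) - f b * Real.exp (-Q v)|
      ≤ f b * C * t * (‖v‖ ^ 3 * Real.exp (-(t * c * ‖v‖ ^ 2)))
        + (K + f b) * (‖v‖ ^ 1 * Real.exp (-(t * c * ‖v‖ ^ 2)))
        + Real.exp (-(t * c)) * f (b + v) := by
  have hfb := hf b
  have hfbv := hf (b + v)
  rcases le_total ‖v‖ 1 with hv | hv
  · refine (h.abs_integrand_sub_le_of_norm_le_one hfb hv (hfK v hv)).trans ?_
    have : 0 ≤ f b * ‖v‖ * Real.exp (-(t * c * ‖v‖ ^ 2)) + Real.exp (-(t * c)) * f (b + v) := by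
      positivity
    linarith
  · refine (h.abs_integrand_sub_le_of_one_le_norm (mul_nonneg ht hc) hf hv).trans ?_
    have : 0 ≤ (f b * C * t * ‖v‖ ^ 3 + K * ‖v‖) * Real.exp (-(t * c * ‖v‖ ^ 2)) := by
      positivity
    linarith

end Pointwise

variable {V : Type*} [NormedAddCommGroup V] [InnerProductSpace ℝ V] [FiniteDimensional ℝ V]
  [MeasurableSpace V] [BorelSpace V] {t c L C K : ℝ} {D Q f : V → ℝ} {b : V}

lemma integrable_exp_neg_phase_mul (h : IsLaplacePhase t c L C D Q) (htc : 0 ≤ t * c)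
    (hfi : Integrable f) (b : V) : Integrable fun v => Real.exp (-D v) * f (b + v) := by
  have hD := h.continuous_phase
  refine (hfi.comp_add_left b).bdd_mul (c := 1)
    (Continuous.aestronglyMeasurable (by fun_prop)) (ae_of_all _ fun v => ?_)
  rw [Real.norm_of_nonneg (Real.exp_pos _).le, Real.exp_le_one_iff, neg_nonpos]
  exact (mul_nonneg htc (huber_nonneg (norm_nonneg v))).trans (h.huber_le v)

lemma integrable_exp_neg_quad (h : IsLaplacePhase t c L C D Q) (htc : 0 < t * c) :
    Integrable fun v => Real.exp (-Q v) := by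
  have hQ := h.continuous_quad
  refine (integrable_exp_neg_mul_sq_norm (V := V) htc).mono'
    (Continuous.aestronglyMeasurable (by fun_prop)) (ae_of_all _ fun v => ?_)
  rw [Real.norm_of_nonneg (Real.exp_pos _).le]
  exact Real.exp_le_exp.2 (neg_le_neg (h.mul_sq_le v))

lemma gaussianMoment_le_integral_exp_neg_quad (h : IsLaplacePhase t c L C D Q)
    (htc : 0 < t * c) (htL : 0 < t * L) :
    gaussianMoment V (t * L) 0 ≤ ∫ v, Real.exp (-Q v) := by
  simp only [gaussianMoment, pow_zero, one_mul]
  exact integral_mono (integrable_exp_neg_mul_sq_norm htL) (h.integrable_exp_neg_quad htc)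
    fun v => Real.exp_le_exp.2 (neg_le_neg (h.le_mul_sq v))

lemma abs_integral_sub_le (h : IsLaplacePhase t c L C D Q) (ht : 0 < t) (hc : 0 < c)
    (hC : 0 ≤ C) (hK : 0 ≤ K) (hf : ∀ v, 0 ≤ f v) (hfi : Integrable f)
    (hfK : ∀ v, ‖v‖ ≤ 1 → |f (b + v) - f b| ≤ K * ‖v‖) :
    |(∫ v, Real.exp (-D v) * f (b + v)) - f b * ∫ v, Real.exp (-Q v)|
      ≤ f b * C * t * gaussianMoment V (t * c) 3 + (K + f b) * gaussianMoment V (t * c) 1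
        + Real.exp (-(t * c)) * ∫ v, f v := by
  have htc : 0 < t * c := mul_pos ht hc
  have hphase := h.integrable_exp_neg_phase_mul htc.le hfi b
  have hquad := (h.integrable_exp_neg_quad htc).const_mul (f b)
  have hcubic := (integrable_pow_mul_exp_neg_mul_sq_norm (V := V) htc 3).const_mul (f b * C * t)
  have hlinear := (integrable_pow_mul_exp_neg_mul_sq_norm (V := V) htc 1).const_mul (K + f b)
  have htail := (hfi.comp_add_left b).const_mul (Real.exp (-(t * c)))
  rw [← integral_const_mul, ← integral_sub hphase hquad]
  refine abs_integral_le_integral_abs.trans ((integral_mono (hphase.sub hquad).abs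
    ((hcubic.add hlinear).add htail)
    (h.abs_integrand_sub_le ht.le hc.le hC hK hf hfK)).trans_eq ?_)
  rw [integral_add' (hcubic.add hlinear) htail, integral_add' hcubic hlinear,
    integral_const_mul, integral_const_mul, integral_const_mul, integral_add_left_eq_self]
  rfl

end IsLaplacePhase

lemma isBigO_exp_neg_mul_inv_sqrt_pow {c : ℝ} (hc : 0 < c) (k : ℕ) :
    (fun t => Real.exp (-(t * c))) =O[atTop] fun t => (√t ^ k)⁻¹ := by
  refine (isLittleO_exp_neg_mul_rpow_atTop hc (-(k / 2 : ℝ))).isBigO.congr' ?_ ?_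
  · exact Eventually.of_forall fun t => by ring_nf
  · filter_upwards [eventually_ge_atTop 0] with t ht
    rw [Real.rpow_neg ht, Real.sqrt_eq_rpow, ← Real.rpow_mul_natCast ht]
    ring_nf

variable {V : Type*} [NormedAddCommGroup V] [InnerProductSpace ℝ V] [FiniteDimensional ℝ V]
  [MeasurableSpace V] [BorelSpace V] {c L C K p : ℝ} {f : V → ℝ}
  {α : Type*} {l : Filter α} {t : α → ℝ} {D Q : α → V → ℝ} {b : α → V}

lemma isBigO_laplace_integral_sub (ht : Tendsto t l atTop) (hc : 0 < c) (hC : 0 ≤ C)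
    (hK : 0 ≤ K) (hDQ : ∀ᶠ n in l, IsLaplacePhase (t n) c L C (D n) (Q n))
    (hf : ∀ v, 0 ≤ f v) (hfi : Integrable f)
    (hfK : ∀ᶠ n in l, ∀ v, ‖v‖ ≤ 1 → |f (b n + v) - f (b n)| ≤ K * ‖v‖)
    (hfb : Tendsto (fun n => f (b n)) l (𝓝 p)) :
    (fun n => (∫ v, Real.exp (-D n v) * f (b n + v)) - f (b n) * ∫ v, Real.exp (-Q n v))
      =O[l] fun n => (√(t n) ^ (Module.finrank ℝ V + 1))⁻¹ := by
  set q := Module.finrank ℝ V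
  have hscaled : (fun n => (f (b n) * C * gaussianMoment V c 3
        + (K + f (b n)) * gaussianMoment V c 1) * (√(t n) ^ (q + 1))⁻¹)
      =O[l] fun n => (√(t n) ^ (q + 1))⁻¹ := by
    have hbdd := ((hfb.mul_const C).mul_const (gaussianMoment V c 3)).add
      ((hfb.const_add K).mul_const (gaussianMoment V c 1)) |>.isBigO_one ℝ
    simpa only [one_mul] using hbdd.mul (isBigO_refl (fun n => (√(t n) ^ (q + 1))⁻¹) l)
  have htail : (fun n => Real.exp (-(t n * c)) * ∫ v, f v)
      =O[l] fun n => (√(t n) ^ (q + 1))⁻¹ := by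
    simp only [mul_comm _ (∫ v, f v)]
    exact ((isBigO_exp_neg_mul_inv_sqrt_pow hc (q + 1)).comp_tendsto ht).const_mul_left _
  refine IsBigO.trans (IsBigO.of_norm_eventuallyLE ?_) (hscaled.add htail)
  filter_upwards [hDQ, hfK, ht.eventually_gt_atTop 0] with n hDQn hfKn htn
  refine (hDQn.abs_integral_sub_le htn hc hC hK hf hfi hfKn).trans_eq ?_
  have hcube : t n * (√(t n) ^ (q + 3))⁻¹ = (√(t n) ^ (q + 1))⁻¹ := by
    have hs : √(t n) ≠ 0 := (Real.sqrt_pos.2 htn).ne'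
    rw [pow_add _ q 3, pow_add _ q 1]
    nth_rewrite 1 [← Real.sq_sqrt htn.le]
    field_simp
  rw [gaussianMoment_mul c 3 htn, gaussianMoment_mul c 1 htn]
  linear_combination f (b n) * C * gaussianMoment V c 3 * hcube

lemma laplace_method (ht : Tendsto t l atTop) (hc : 0 < c) (hL : 0 < L) (hC : 0 ≤ C)
    (hK : 0 ≤ K) (hDQ : ∀ᶠ n in l, IsLaplacePhase (t n) c L C (D n) (Q n))
    (hf : ∀ v, 0 ≤ f v) (hfi : Integrable f)
    (hfK : ∀ᶠ n in l, ∀ v, ‖v‖ ≤ 1 → |f (b n + v) - f (b n)| ≤ K * ‖v‖)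
    (hp : 0 < p) (hfb : Tendsto (fun n => f (b n)) l (𝓝 p)) :
    (∀ᶠ n in l, 0 < ∫ v, Real.exp (-D n v) * f (b n + v)) ∧
      (fun n => Real.log (∫ v, Real.exp (-D n v) * f (b n + v))
        - Real.log (f (b n) * ∫ v, Real.exp (-Q n v))) =O[l] fun n => (√(t n))⁻¹ := by
  set q := Module.finrank ℝ V
  have hlow : ∀ᶠ n in l, p / 2 * ((√(t n) ^ q)⁻¹ * gaussianMoment V L 0)
      ≤ f (b n) * ∫ v, Real.exp (-Q n v) := by
    filter_upwards [hDQ, ht.eventually_gt_atTop 0,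
      hfb.eventually (le_mem_nhds (half_lt_self hp))] with n hDQn htn hpn
    have hgauss := hDQn.gaussianMoment_le_integral_exp_neg_quad (mul_pos htn hc) (mul_pos htn hL)
    rw [gaussianMoment_mul L 0 htn, add_zero] at hgauss
    exact mul_le_mul hpn hgauss
      (mul_nonneg (by positivity) (gaussianMoment_nonneg L 0)) (hf _)
  have hm : 0 < gaussianMoment V L 0 := gaussianMoment_zero_pos hL
  refine eventually_pos_and_isBigO_log_sub_log ?_
    (tendsto_inv_atTop_zero.comp (Real.tendsto_sqrt_atTop.comp ht)) ?_
  · filter_upwards [hlow, ht.eventually_gt_atTop 0] with n hn htn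
    have := Real.sqrt_pos.2 htn
    exact lt_of_lt_of_le (by positivity) hn
  · refine (isBigO_laplace_integral_sub ht hc hC hK hDQ hf hfi hfK hfb).trans
      (IsBigO.of_bound (p / 2 * gaussianMoment V L 0)⁻¹ ?_)
    filter_upwards [hlow] with n hn
    rw [Real.norm_of_nonneg (by positivity), Real.norm_of_nonneg
      (mul_nonneg (by positivity) ((by positivity : (0 : ℝ) ≤ _).trans hn)),
      inv_mul_eq_div, le_div_iff₀ (by positivity), pow_succ, mul_inv]
    calc (√(t n) ^ q)⁻¹ * (√(t n))⁻¹ * (p / 2 * gaussianMoment V L 0)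
        = (√(t n))⁻¹ * (p / 2 * ((√(t n) ^ q)⁻¹ * gaussianMoment V L 0)) := by ring
      _ ≤ _ := by gcongr

end Laplace

section Argmax

variable {V : Type*} [NormedAddCommGroup V] [InnerProductSpace ℝ V] {f : V → ℝ} {b b' g : V}
  {a δ : ℝ}

/-- `f` lies below its would-be tangent of slope `g` at `b` by a Huber function with factor `a`;
the form in which strict concavity of the log-likelihood, uniform in `n`, is used. -/
def HasHuberGap (f : V → ℝ) (b g : V) (a : ℝ) : Prop :=
  ∀ h, f (b + h) ≤ f b + inner ℝ h g - a * huber ‖h‖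

lemma HasHuberGap.lt_of_le_norm_sub (hf : HasHuberGap f b g a) (ha : 0 ≤ a) (hδ : 0 < δ)
    (hg : ‖g‖ < a * min 1 δ) (hb' : δ ≤ ‖b' - b‖) : f b' < f b := by
  have hgap := hf (b' - b)
  rw [add_sub_cancel] at hgap
  have hslope : ‖g‖ < a * min 1 ‖b' - b‖ :=
    hg.trans_le (mul_le_mul_of_nonneg_left (min_le_min_left 1 hb') ha)
  have hinner : inner ℝ (b' - b) g < a * huber ‖b' - b‖ :=
    calc inner ℝ (b' - b) g ≤ ‖b' - b‖ * ‖g‖ := real_inner_le_norm _ _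
      _ < ‖b' - b‖ * (a * min 1 ‖b' - b‖) := by gcongr; exact hδ.trans_le hb'
      _ = a * huber ‖b' - b‖ := by rw [huber]; ring
  linarith

lemma HasHuberGap.exists_isArgmax [ProperSpace V] (hf : HasHuberGap f b g a)
    (hcont : Continuous f) (ha : 0 ≤ a) (hδ : 0 < δ) (hg : ‖g‖ < a * min 1 δ) :
    ∃ m, IsArgmax f m := by
  obtain ⟨m, -, hmax⟩ := (isCompact_closedBall b δ).exists_isMaxOn
    ⟨b, Metric.mem_closedBall_self hδ.le⟩ hcont.continuousOn
  refine ⟨m, fun b' => ?_⟩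
  by_cases hb' : b' ∈ Metric.closedBall b δ
  · exact hmax hb'
  · rw [mem_closedBall_iff_norm, not_le] at hb'
    exact (hf.lt_of_le_norm_sub ha hδ hg hb'.le).le.trans
      (hmax (Metric.mem_closedBall_self hδ.le))

lemma IsArgmax.norm_sub_lt (hb' : IsArgmax f b') (hf : HasHuberGap f b g a) (ha : 0 ≤ a)
    (hδ : 0 < δ) (hg : ‖g‖ < a * min 1 δ) : ‖b' - b‖ < δ := by
  by_contra! hle
  exact (hf.lt_of_le_norm_sub ha hδ hg hle).not_ge (hb' b)

lemma IsArgmax.eq_of_hasHuberGap (hb' : IsArgmax f b') (hf : HasHuberGap f b 0 a) (ha : 0 < a) :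
    b' = b := by
  by_contra hne
  have hpos : 0 < ‖b' - b‖ := norm_pos_iff.2 (sub_ne_zero.2 hne)
  have hg : ‖(0 : V)‖ < a * min 1 ‖b' - b‖ := by rw [norm_zero]; positivity
  exact lt_irrefl _ (hb'.norm_sub_lt hf ha.le hpos hg)

lemma IsArgmax.eq_zero_of_hasGradientAt [CompleteSpace V] (hb : IsArgmax f b)
    (hf : HasGradientAt f g b) : g = 0 := by
  have hmax : IsLocalMax f b := Eventually.of_forall hb
  simpa using hmax.hasFDerivAt_eq_zero hf.hasFDerivAt

lemma eventually_isArgmax_and_tendsto_sub [ProperSpace V] {α : Type*} {l : Filter α} {t : α → ℝ}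
    {F : α → V → ℝ} {b g m : α → V} (ha : 0 < a) (ht : ∀ᶠ n in l, 0 < t n)
    (hcont : ∀ᶠ n in l, Continuous (F n))
    (hgap : ∀ᶠ n in l, HasHuberGap (F n) (b n) (g n) (t n * a))
    (hg : Tendsto (fun n => (t n)⁻¹ • g n) l (𝓝 0))
    (hm : ∀ᶠ n in l, (∃ x, IsArgmax (F n) x) → IsArgmax (F n) (m n)) :
    (∀ᶠ n in l, IsArgmax (F n) (m n)) ∧ Tendsto (fun n => m n - b n) l (𝓝 0) := by
  have hsmall : ∀ δ > 0, ∀ᶠ n in l, ‖g n‖ < t n * a * min 1 δ := by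
    intro δ hδ
    have hpos : 0 < a * min 1 δ := by positivity
    filter_upwards [ht, hg.norm.eventually (gt_mem_nhds (by rwa [norm_zero]))] with n htn hgn
    rw [norm_smul, norm_inv, Real.norm_of_nonneg htn.le, inv_mul_lt_iff₀ htn] at hgn
    rwa [mul_assoc]
  have hargmax : ∀ᶠ n in l, IsArgmax (F n) (m n) := by
    filter_upwards [ht, hcont, hgap, hsmall 1 one_pos, hm] with n htn hcn hgn hsn hmn
    exact hmn (hgn.exists_isArgmax hcn (by positivity) one_pos hsn)
  refine ⟨hargmax, Metric.tendsto_nhds.2 fun δ hδ => ?_⟩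
  filter_upwards [ht, hargmax, hgap, hsmall δ hδ] with n htn hmn hgn hsn
  rw [dist_zero_right]
  exact hmn.norm_sub_lt hgn (by positivity) hδ hsn

end Argmax

section Bounded

variable {U V : Type*} [MeasurableSpace U] {ν : Measure U} [IsFiniteMeasure ν]
  [NormedAddCommGroup V] [ProperSpace V] {z : U → V} {M : ℝ}

lemma integrable_comp_of_norm_le {E : Type*}
    [NormedAddCommGroup E] {G : V → E} (hG : Continuous G) (hz : AEStronglyMeasurable z ν)
    (hM : ∀ u, ‖z u‖ ≤ M) : Integrable (fun u => G (z u)) ν := by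
  obtain ⟨A, hA⟩ := (isCompact_closedBall (0 : V) M).exists_bound_of_continuousOn hG.continuousOn
  exact .of_bound (hG.comp_aestronglyMeasurable hz) A
    (ae_of_all _ fun u => hA _ (mem_closedBall_zero_iff.2 (hM u)))

lemma continuous_integral_comp_of_norm_le {X : Type*}
    [TopologicalSpace X] [FirstCountableTopology X] [WeaklyLocallyCompactSpace X]
    {G : X → V → ℝ} (hG : Continuous fun p : X × V => G p.1 p.2)
    (hz : AEStronglyMeasurable z ν) (hM : ∀ u, ‖z u‖ ≤ M) :
    Continuous fun x => ∫ u, G x (z u) ∂ν := by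
  refine continuous_iff_continuousAt.2 fun x₀ => ?_
  obtain ⟨K, hK, hx₀⟩ := exists_compact_mem_nhds x₀
  obtain ⟨A, hA⟩ :=
    (hK.prod (isCompact_closedBall (0 : V) M)).exists_bound_of_continuousOn hG.continuousOn
  refine continuousAt_of_dominated (bound := fun _ => A) (Eventually.of_forall fun x => ?_) ?_
    (integrable_const A) (ae_of_all _ fun u => ?_)
  · exact (hG.comp (.prodMk_right x)).comp_aestronglyMeasurable hz
  · filter_upwards [hx₀] with x hx
    exact ae_of_all _ fun u => hA (x, z u) ⟨hx, mem_closedBall_zero_iff.2 (hM u)⟩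
  · exact (hG.comp (.prodMk_left (z u))).continuousAt

end Bounded

section Tilted

variable {U V : Type*} [NormedAddCommGroup V] [InnerProductSpace ℝ V] {z : U → V} {b h : V}
  {M R : ℝ}

lemma abs_inner_le_mul (hM : ∀ u, ‖z u‖ ≤ M) (hb : ‖b‖ ≤ R) (u : U) :
    |inner ℝ b (z u)| ≤ R * M :=
  (abs_real_inner_le_norm _ _).trans
    (mul_le_mul hb (hM u) (norm_nonneg _) ((norm_nonneg _).trans hb))

variable [MeasurableSpace U] {ν : Measure U}

/-- The integral of `φ ⟪h, z⟫` under the exponential tilt of `ν` by `⟪b, z⟫`. With `ν` the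
(scaled) Lebesgue measure of a window, `φ s = s ^ 2` gives the sensitivity form of the
log-likelihood at `b`, and `φ = expRem` its loss from `b` to `b + h`, up to the linear term. -/
noncomputable def tiltedIntegral (ν : Measure U) (z : U → V) (b : V) (φ : ℝ → ℝ) (h : V) : ℝ :=
  ∫ u, Real.exp (inner ℝ b (z u)) * φ (inner ℝ h (z u)) ∂ν

/-- The mean of `z` under the exponential tilt of `ν` by `⟪b, z⟫`, without normalization. -/
noncomputable def tiltedMean (ν : Measure U) (z : U → V) (b : V) : V :=
  ∫ u, Real.exp (inner ℝ b (z u)) • z u ∂ν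

/-- Uniformly over the directions `h`, the covariate `⟪h, z⟫` is at least `c ‖h‖` in absolute
value on a proportion `κ` of the space. -/
def IsNondegenerate (ν : Measure U) (z : U → V) (c κ : ℝ) : Prop :=
  ∀ h, κ * ν.real Set.univ ≤ ν.real {u | c * ‖h‖ ≤ |inner ℝ h (z u)|}

variable [IsFiniteMeasure ν] {φ : ℝ → ℝ}

section Proper

variable [ProperSpace V]

lemma integrable_tilted (hφ : Continuous φ) (hz : AEStronglyMeasurable z ν)
    (hM : ∀ u, ‖z u‖ ≤ M) (b h : V) :
    Integrable (fun u => Real.exp (inner ℝ b (z u)) * φ (inner ℝ h (z u))) ν :=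
  integrable_comp_of_norm_le (G := fun v => Real.exp (inner ℝ b v) * φ (inner ℝ h v))
    (by fun_prop) hz hM

lemma continuous_tiltedIntegral (hφ : Continuous φ) (hz : AEStronglyMeasurable z ν)
    (hM : ∀ u, ‖z u‖ ≤ M) (b : V) : Continuous (tiltedIntegral ν z b φ) :=
  continuous_integral_comp_of_norm_le
    (G := fun h v => Real.exp (inner ℝ b v) * φ (inner ℝ h v)) (by fun_prop) hz hM

lemma integral_exp_inner_add (hz : AEStronglyMeasurable z ν) (hM : ∀ u, ‖z u‖ ≤ M) (b h : V) :
    ∫ u, Real.exp (inner ℝ (b + h) (z u)) ∂ν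
      = (∫ u, Real.exp (inner ℝ b (z u)) ∂ν) + inner ℝ h (tiltedMean ν z b)
        + tiltedIntegral ν z b expRem h := by
  have hmass : Integrable (fun u => Real.exp (inner ℝ b (z u))) ν :=
    integrable_comp_of_norm_le (G := fun v => Real.exp (inner ℝ b v)) (by fun_prop) hz hM
  have hmean : Integrable (fun u => Real.exp (inner ℝ b (z u)) • z u) ν :=
    integrable_comp_of_norm_le (G := fun v => Real.exp (inner ℝ b v) • v) (by fun_prop) hz hM
  rw [tiltedMean, tiltedIntegral, ← integral_inner hmean,
    ← integral_add' hmass (hmean.const_inner h),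
    ← integral_add' (hmass.add (hmean.const_inner h))
      (integrable_tilted continuous_expRem hz hM b h)]
  congr 1 with u
  simp only [Pi.add_apply]
  rw [inner_add_left, Real.exp_add, inner_smul_right, expRem]
  ring

lemma le_tiltedIntegral {c κ a : ℝ} (hnd : IsNondegenerate ν z c κ) (hφ : Continuous φ)
    (hφ0 : ∀ s, 0 ≤ φ s) (hz : AEStronglyMeasurable z ν) (hM : ∀ u, ‖z u‖ ≤ M) (hb : ‖b‖ ≤ R)
    (ha : 0 ≤ a) (haφ : ∀ s, c * ‖h‖ ≤ |s| → a ≤ φ s) :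
    ν.real Set.univ * (κ * Real.exp (-(R * M))) * a ≤ tiltedIntegral ν z b φ h := by
  calc ν.real Set.univ * (κ * Real.exp (-(R * M))) * a
      = Real.exp (-(R * M)) * a * (κ * ν.real Set.univ) := by ring
    _ ≤ Real.exp (-(R * M)) * a * ν.real {u | c * ‖h‖ ≤ |inner ℝ h (z u)|} := by
        gcongr
        exact hnd h
    _ ≤ Real.exp (-(R * M)) * a * ν.real {u | Real.exp (-(R * M)) * a
          ≤ Real.exp (inner ℝ b (z u)) * φ (inner ℝ h (z u))} := by
        refine mul_le_mul_of_nonneg_left (measureReal_mono fun u hu => ?_) (by positivity)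
        exact mul_le_mul (Real.exp_le_exp.2 (neg_le_of_abs_le (abs_inner_le_mul hM hb u)))
          (haφ _ hu) ha (Real.exp_pos _).le
    _ ≤ tiltedIntegral ν z b φ h :=
        mul_meas_ge_le_integral_of_nonneg
          (ae_of_all _ fun u => mul_nonneg (Real.exp_pos _).le (hφ0 _))
          (integrable_tilted hφ hz hM b h) _

end Proper

lemma abs_tiltedIntegral_le {A : ℝ} (hM : ∀ u, ‖z u‖ ≤ M) (hb : ‖b‖ ≤ R)
    (hA : ∀ s, |s| ≤ ‖h‖ * M → |φ s| ≤ A) :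
    |tiltedIntegral ν z b φ h| ≤ ν.real Set.univ * (Real.exp (R * M) * A) := by
  rw [mul_comm, tiltedIntegral, ← Real.norm_eq_abs]
  refine norm_integral_le_of_norm_le_const (ae_of_all _ fun u => ?_)
  rw [norm_mul, Real.norm_of_nonneg (Real.exp_pos _).le]
  exact mul_le_mul (Real.exp_le_exp.2 (le_of_abs_le (abs_inner_le_mul hM hb u)))
    (hA _ (abs_inner_le_mul hM le_rfl u)) (norm_nonneg _) (Real.exp_pos _).le

lemma tiltedIntegral_sq_le (hM : ∀ u, ‖z u‖ ≤ M) (hb : ‖b‖ ≤ R) (h : V) :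
    tiltedIntegral ν z b (· ^ 2) h
      ≤ ν.real Set.univ * (Real.exp (R * M) * M ^ 2) * ‖h‖ ^ 2 := by
  refine (le_abs_self _).trans ((abs_tiltedIntegral_le (ν := ν) hM hb (A := (‖h‖ * M) ^ 2)
    fun s hs => ?_).trans_eq (by ring))
  rw [abs_pow]
  gcongr

variable [ProperSpace V]

lemma abs_tiltedIntegral_expRem_sub_le (hz : AEStronglyMeasurable z ν) (hM : ∀ u, ‖z u‖ ≤ M)
    (hM0 : 0 ≤ M) (hb : ‖b‖ ≤ R) (hh : ‖h‖ ≤ 1) :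
    |tiltedIntegral ν z b expRem h - tiltedIntegral ν z b (· ^ 2) h / 2|
      ≤ ν.real Set.univ * (Real.exp (R * M) * (M ^ 3 * Real.exp M)) * ‖h‖ ^ 3 := by
  have hsub : tiltedIntegral ν z b expRem h - tiltedIntegral ν z b (· ^ 2) h / 2
      = tiltedIntegral ν z b (fun s => expRem s - s ^ 2 / 2) h := by
    simp only [tiltedIntegral]
    rw [← integral_div, ← integral_sub (integrable_tilted continuous_expRem hz hM b h)
      ((integrable_tilted (continuous_pow 2) hz hM b h).div_const 2)]
    congr 1 with u
    ring
  rw [hsub]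
  refine (abs_tiltedIntegral_le hM hb (A := (‖h‖ * M) ^ 3 * Real.exp M)
    fun s hs => (abs_expRem_sub_le s).trans ?_).trans_eq (by ring)
  gcongr
  exact hs.trans (mul_le_of_le_one_left hM0 hh)

lemma isLittleO_tiltedIntegral_expRem (hz : AEStronglyMeasurable z ν) (hM : ∀ u, ‖z u‖ ≤ M)
    (hM0 : 0 ≤ M) (b : V) : tiltedIntegral ν z b expRem =o[𝓝 0] fun h => h := by
  refine IsBigO.trans_isLittleO ?_ (isLittleO_norm_pow_id one_lt_two)
  refine .of_bound (ν.real Set.univ * (Real.exp (‖b‖ * M) * (M ^ 3 * Real.exp M))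
    + ν.real Set.univ * (Real.exp (‖b‖ * M) * M ^ 2) / 2) ?_
  filter_upwards [Metric.closedBall_mem_nhds (0 : V) one_pos] with h hh
  rw [mem_closedBall_zero_iff] at hh
  have hcubic := (abs_tiltedIntegral_expRem_sub_le hz hM hM0 (le_refl ‖b‖) hh).trans
    (mul_le_mul_of_nonneg_left (pow_le_pow_of_le_one (norm_nonneg h) hh (Nat.le_succ 2))
      (by positivity))
  have hsq := tiltedIntegral_sq_le (ν := ν) hM (le_refl ‖b‖) h
  have hnonneg : 0 ≤ tiltedIntegral ν z b expRem h :=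
    integral_nonneg fun u => mul_nonneg (Real.exp_pos _).le (expRem_nonneg _)
  rw [norm_pow, norm_norm, Real.norm_of_nonneg hnonneg]
  linarith [le_of_abs_le hcubic]

/-- The rate of the Huber gap of the log-likelihood, per unit of total mass, at parameters of
norm at most `R`: nondegeneracy with constants `c` and `κ`, covariates bounded by `M`. -/
noncomputable def gapRate (c κ M R : ℝ) : ℝ := κ * Real.exp (-(R * M)) * (huber c / 4)

lemma gapRate_pos {c κ : ℝ} (hc : 0 < c) (hκ : 0 < κ) (M R : ℝ) : 0 < gapRate c κ M R := by
  have := huber_pos hc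
  unfold gapRate
  positivity

variable {c κ : ℝ}

lemma le_tiltedIntegral_expRem (hc : 0 ≤ c) (hκ : 0 ≤ κ) (hnd : IsNondegenerate ν z c κ)
    (hz : AEStronglyMeasurable z ν) (hM : ∀ u, ‖z u‖ ≤ M) (hb : ‖b‖ ≤ R) (h : V) :
    ν.real Set.univ * gapRate c κ M R * huber ‖h‖ ≤ tiltedIntegral ν z b expRem h := by
  have hch : 0 ≤ c * ‖h‖ := by positivity
  calc ν.real Set.univ * gapRate c κ M R * huber ‖h‖
      = ν.real Set.univ * (κ * Real.exp (-(R * M))) * (huber c * huber ‖h‖ / 4) := by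
        unfold gapRate; ring
    _ ≤ ν.real Set.univ * (κ * Real.exp (-(R * M))) * (huber (c * ‖h‖) / 4) := by
        gcongr
        exact huber_mul_huber_le hc (norm_nonneg h)
    _ ≤ tiltedIntegral ν z b expRem h :=
        le_tiltedIntegral hnd continuous_expRem expRem_nonneg hz hM hb
          (div_nonneg (huber_nonneg hch) zero_le_four) fun s hs => huber_div_four_le_expRem hch hs

lemma le_tiltedIntegral_sq (hc : 0 ≤ c) (hκ : 0 ≤ κ) (hnd : IsNondegenerate ν z c κ)
    (hz : AEStronglyMeasurable z ν) (hM : ∀ u, ‖z u‖ ≤ M) (hb : ‖b‖ ≤ R) (h : V) :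
    ν.real Set.univ * gapRate c κ M R * ‖h‖ ^ 2 ≤ tiltedIntegral ν z b (· ^ 2) h / 2 := by
  have hlow : ν.real Set.univ * (κ * Real.exp (-(R * M))) * (c * ‖h‖) ^ 2
      ≤ tiltedIntegral ν z b (· ^ 2) h :=
    le_tiltedIntegral hnd (continuous_pow 2) sq_nonneg hz hM hb (sq_nonneg _)
      fun s hs => by rw [← sq_abs s]; gcongr
  have hrate : huber c / 4 ≤ c ^ 2 / 2 := by linarith [huber_le_sq hc, sq_nonneg c]
  calc ν.real Set.univ * gapRate c κ M R * ‖h‖ ^ 2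
      ≤ ν.real Set.univ * (κ * Real.exp (-(R * M)) * (c ^ 2 / 2)) * ‖h‖ ^ 2 := by
        unfold gapRate
        exact mul_le_mul_of_nonneg_right (mul_le_mul_of_nonneg_left
          (mul_le_mul_of_nonneg_left hrate (by positivity)) measureReal_nonneg) (sq_nonneg _)
    _ = ν.real Set.univ * (κ * Real.exp (-(R * M))) * (c * ‖h‖) ^ 2 / 2 := by ring
    _ ≤ tiltedIntegral ν z b (· ^ 2) h / 2 := by gcongr

lemma isLaplacePhase_tiltedIntegral (hc : 0 ≤ c) (hκ : 0 ≤ κ) (hnd : IsNondegenerate ν z c κ)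
    (hz : AEStronglyMeasurable z ν) (hM : ∀ u, ‖z u‖ ≤ M) (hM0 : 0 ≤ M) (hb : ‖b‖ ≤ R) :
    IsLaplacePhase (ν.real Set.univ) (gapRate c κ M R) (Real.exp (R * M) * M ^ 2 / 2)
      (Real.exp (R * M) * (M ^ 3 * Real.exp M))
      (tiltedIntegral ν z b expRem) (fun h => tiltedIntegral ν z b (· ^ 2) h / 2) where
  continuous_phase := continuous_tiltedIntegral continuous_expRem hz hM b
  continuous_quad := (continuous_tiltedIntegral (continuous_pow 2) hz hM b).div_const 2
  huber_le := le_tiltedIntegral_expRem hc hκ hnd hz hM hb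
  mul_sq_le := le_tiltedIntegral_sq hc hκ hnd hz hM hb
  le_mul_sq h := by linarith [tiltedIntegral_sq_le (ν := ν) hM hb h]
  abs_sub_le _ hh := abs_tiltedIntegral_expRem_sub_le hz hM hM0 hb hh

end Tilted

section Window

variable {d : ℕ} {θ : ℝ} {W : Set (Space d)}

/-- Lebesgue measure on the window `W`, scaled by `θ`: it turns the compensators of the
log-likelihood and of its derivatives into integrals over the whole space. -/
noncomputable def windowMeasure (θ : ℝ) (W : Set (Space d)) : Measure (Space d) :=
  ENNReal.ofReal θ • volume.restrict W

lemma isFiniteMeasure_windowMeasure (hW : volume W ≠ ⊤) : IsFiniteMeasure (windowMeasure θ W) := by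
  have : IsFiniteMeasure (volume.restrict W) := isFiniteMeasure_restrict.2 hW
  exact Measure.smul_finite _ ENNReal.ofReal_ne_top

lemma integral_windowMeasure {E : Type*} [NormedAddCommGroup E] [NormedSpace ℝ E] (hθ : 0 ≤ θ)
    (f : Space d → E) : ∫ u, f u ∂windowMeasure θ W = θ • ∫ u in W, f u := by
  rw [windowMeasure, integral_smul_measure, ENNReal.toReal_ofReal hθ]

lemma windowMeasure_real_apply (hθ : 0 ≤ θ) {B : Set (Space d)} (hB : MeasurableSet B) :
    (windowMeasure θ W).real B = θ * volume.real (B ∩ W) := by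
  rw [windowMeasure, measureReal_ennreal_smul_apply, ENNReal.toReal_ofReal hθ,
    measureReal_restrict_apply hB]

lemma windowMeasure_real_univ (hθ : 0 ≤ θ) :
    (windowMeasure θ W).real Set.univ = θ * volume.real W := by
  rw [windowMeasure_real_apply hθ .univ, Set.univ_inter]

end Window

section Model

variable {d p : ℕ} {I : Finset (Fin p)} {θ : ℝ} {W : Set (Space d)} {zl : Space d → Param I}
  {x : Set (Space d)} {b : Param I} {c κ M R : ℝ}

lemma isNondegenerate_windowMeasure (hθ : 0 ≤ θ) (hW : volume W ≠ ⊤)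
    (hB : ∀ φ : Param I, ‖φ‖ = 1 → ∃ B ⊆ W, MeasurableSet B ∧
      κ * volume.real W ≤ volume.real B ∧ ∀ u ∈ B, c ≤ |inner ℝ φ (zl u)|) :
    IsNondegenerate (windowMeasure θ W) zl c κ := by
  have := isFiniteMeasure_windowMeasure (θ := θ) hW
  intro h
  obtain ⟨φ, hφ, hφh⟩ : ∃ φ : Param I, ‖φ‖ = 1 ∧ h = ‖h‖ • φ := by
    rcases eq_or_ne h 0 with rfl | hh
    · exact ⟨EuclideanSpace.single none 1, by simp, by simp⟩
    · exact ⟨‖h‖⁻¹ • h, norm_smul_inv_norm hh, (smul_inv_smul₀ (norm_ne_zero_iff.2 hh) h).symm⟩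
  obtain ⟨B, hBW, hBm, hBvol, hBc⟩ := hB φ hφ
  calc κ * (windowMeasure θ W).real Set.univ = θ * (κ * volume.real W) := by
        rw [windowMeasure_real_univ hθ]; ring
    _ ≤ θ * volume.real B := by gcongr
    _ = (windowMeasure θ W).real B := by
        rw [windowMeasure_real_apply hθ hBm, Set.inter_eq_left.2 hBW]
    _ ≤ (windowMeasure θ W).real {u | c * ‖h‖ ≤ |inner ℝ h (zl u)|} := by
        refine measureReal_mono fun u hu => ?_
        rw [Set.mem_ofPred_eq, hφh, real_inner_smul_left, abs_mul, norm_smul, hφ, mul_one,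
          norm_norm, abs_norm, mul_comm]
        exact mul_le_mul_of_nonneg_left (hBc u hu) (norm_nonneg h)

lemma logLik_eq_sub_integral (hθ : 0 ≤ θ) (β : Param I) :
    logLik θ W zl x β
      = (∑ᶠ u ∈ x ∩ W, inner ℝ β (zl u))
        - ∫ u, Real.exp (inner ℝ β (zl u)) ∂windowMeasure θ W := by
  rw [logLik, integral_windowMeasure hθ, smul_eq_mul]

lemma score_eq_sub_tiltedMean (hθ : 0 ≤ θ) (β : Param I) :
    score θ W zl x β = (∑ᶠ u ∈ x ∩ W, zl u) - tiltedMean (windowMeasure θ W) zl β := by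
  rw [score, tiltedMean, integral_windowMeasure hθ]

lemma logLik_add (hθ : 0 ≤ θ) (hW : volume W ≠ ⊤) (hz : Measurable zl) (hM : ∀ u, ‖zl u‖ ≤ M)
    (hx : (x ∩ W).Finite) (b h : Param I) :
    logLik θ W zl x (b + h)
      = logLik θ W zl x b + inner ℝ h (score θ W zl x b)
        - tiltedIntegral (windowMeasure θ W) zl b expRem h := by
  have := isFiniteMeasure_windowMeasure (θ := θ) hW
  have hpoints : ∑ᶠ u ∈ x ∩ W, inner ℝ (b + h) (zl u)
      = (∑ᶠ u ∈ x ∩ W, inner ℝ b (zl u)) + inner ℝ h (∑ᶠ u ∈ x ∩ W, zl u) := by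
    simp only [finsum_mem_eq_finite_toFinset_sum _ hx, inner_add_left, inner_sum,
      Finset.sum_add_distrib]
  rw [logLik_eq_sub_integral hθ, logLik_eq_sub_integral hθ, score_eq_sub_tiltedMean hθ, hpoints,
    integral_exp_inner_add hz.aestronglyMeasurable hM, inner_sub_right]
  ring

lemma continuous_logLik (hθ : 0 ≤ θ) (hW : volume W ≠ ⊤) (hz : Measurable zl)
    (hM : ∀ u, ‖zl u‖ ≤ M) (hx : (x ∩ W).Finite) : Continuous (logLik θ W zl x) := by
  have := isFiniteMeasure_windowMeasure (θ := θ) hW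
  have hexpand : logLik θ W zl x = fun h => logLik θ W zl x 0 + inner ℝ h (score θ W zl x 0)
      - tiltedIntegral (windowMeasure θ W) zl 0 expRem h :=
    funext fun h => by rw [← logLik_add hθ hW hz hM hx, zero_add]
  rw [hexpand]
  have := continuous_tiltedIntegral continuous_expRem
    (hz.aestronglyMeasurable (μ := windowMeasure θ W)) hM 0
  fun_prop

lemma hasGradientAt_logLik (hθ : 0 ≤ θ) (hW : volume W ≠ ⊤) (hz : Measurable zl)
    (hM : ∀ u, ‖zl u‖ ≤ M) (hx : (x ∩ W).Finite) (b : Param I) :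
    HasGradientAt (logLik θ W zl x) (score θ W zl x b) b := by
  have := isFiniteMeasure_windowMeasure (θ := θ) hW
  rw [hasGradientAt_iff_isLittleO_nhds_zero]
  have hrem := isLittleO_tiltedIntegral_expRem
    (hz.aestronglyMeasurable (μ := windowMeasure θ W)) hM ((norm_nonneg _).trans (hM 0)) b
  refine hrem.neg_left.congr_left fun h => ?_
  rw [logLik_add hθ hW hz hM hx, real_inner_comm]
  ring

lemma hasHuberGap_logLik (hθ : 0 ≤ θ) (hW : volume W ≠ ⊤) (hz : Measurable zl)
    (hM : ∀ u, ‖zl u‖ ≤ M) (hx : (x ∩ W).Finite) (hc : 0 ≤ c) (hκ : 0 ≤ κ)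
    (hnd : IsNondegenerate (windowMeasure θ W) zl c κ) (hb : ‖b‖ ≤ R) :
    HasHuberGap (logLik θ W zl x) b (score θ W zl x b)
      (θ * volume.real W * gapRate c κ M R) := by
  have := isFiniteMeasure_windowMeasure (θ := θ) hW
  intro h
  rw [logLik_add hθ hW hz hM hx, ← windowMeasure_real_univ hθ]
  exact sub_le_sub_left
    (le_tiltedIntegral_expRem hc hκ hnd hz.aestronglyMeasurable hM hb h) _

lemma dotProduct_sensitivity_mulVec (hθ : 0 ≤ θ) (hW : volume W ≠ ⊤) (hz : Measurable zl)
    (hM : ∀ u, ‖zl u‖ ≤ M) (b h : Param I) :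
    h.ofLp ⬝ᵥ (sensitivity θ W zl b).mulVec h.ofLp
      = tiltedIntegral (windowMeasure θ W) zl b (· ^ 2) h := by
  have := isFiniteMeasure_windowMeasure (θ := θ) hW
  have hexpand : ∀ u, Real.exp (inner ℝ b (zl u)) * inner ℝ h (zl u) ^ 2
      = ∑ i, ∑ j, h i * h j * (zl u i * zl u j * Real.exp (inner ℝ b (zl u))) := by
    intro u
    have hcoord : inner ℝ h (zl u) = ∑ i, h i * zl u i := by
      simp only [PiLp.inner_apply, RCLike.inner_apply, conj_trivial, mul_comm]
    rw [hcoord, sq, Finset.sum_mul_sum, Finset.mul_sum]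
    refine Finset.sum_congr rfl fun i _ => ?_
    rw [Finset.mul_sum]
    exact Finset.sum_congr rfl fun j _ => by ring
  have hint : ∀ i j, Integrable
      (fun u => h i * h j * (zl u i * zl u j * Real.exp (inner ℝ b (zl u))))
      (windowMeasure θ W) := fun i j =>
    integrable_comp_of_norm_le (G := fun v => h i * h j * (v i * v j * Real.exp (inner ℝ b v)))
      (by fun_prop) hz.aestronglyMeasurable hM
  simp only [tiltedIntegral, hexpand]
  rw [integral_finsetSum _ fun i _ => integrable_finsetSum _ fun j _ => hint i j]
  simp only [integral_finsetSum Finset.univ fun j _ => hint _ j, integral_const_mul,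
    integral_windowMeasure hθ, dotProduct, Matrix.mulVec, sensitivity, Matrix.of_apply,
    Finset.mul_sum, smul_eq_mul]
  exact Finset.sum_congr rfl fun i _ => Finset.sum_congr rfl fun j _ => by ring

lemma posDef_sensitivity (hθ : 0 < θ) (hW : 0 < volume.real W) (hz : Measurable zl)
    (hM : ∀ u, ‖zl u‖ ≤ M) (hc : 0 < c) (hκ : 0 < κ)
    (hnd : IsNondegenerate (windowMeasure θ W) zl c κ) (b : Param I) :
    (sensitivity θ W zl b).PosDef := by
  have hfin : volume W ≠ ⊤ := (ENNReal.toReal_pos_iff.1 hW).2.ne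
  have := isFiniteMeasure_windowMeasure (θ := θ) hfin
  refine .of_dotProduct_mulVec_pos ?_ fun v hv => ?_
  · ext i j
    simp only [sensitivity, Matrix.conjTranspose_apply, Matrix.of_apply, star_trivial, mul_comm]
  · have hquad := dotProduct_sensitivity_mulVec hθ.le hfin hz hM b (WithLp.toLp 2 v)
    have hlow := le_tiltedIntegral_sq hc.le hκ.le hnd hz.aestronglyMeasurable hM (le_refl ‖b‖)
      (WithLp.toLp 2 v)
    have hrate := gapRate_pos hc hκ M ‖b‖
    have hv' : 0 < ‖WithLp.toLp 2 v‖ := norm_pos_iff.2 ((WithLp.toLp_eq_zero 2).not.2 hv)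
    have hpos : 0 < (windowMeasure θ W).real Set.univ * gapRate c κ M ‖b‖
        * ‖WithLp.toLp 2 v‖ ^ 2 := by
      rw [windowMeasure_real_univ hθ.le]
      positivity
    rw [star_trivial]
    linarith

end Model

section Marginal

variable {d p : ℕ} {I : Finset (Fin p)} {θ : ℝ} {W : Set (Space d)} {zl : Space d → Param I}
  {x : Set (Space d)} {b : Param I} {M : ℝ}

lemma poissonDensity_eq (hx : (x ∩ W).Finite) (β : Param I) :
    poissonDensity θ W zl x β
      = Real.exp (volume.real W) * θ ^ (x ∩ W).ncard * Real.exp (logLik θ W zl x β) := by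
  unfold poissonDensity logLik rho
  rw [finprod_mem_eq_finite_toFinset_prod _ hx, finsum_mem_eq_finite_toFinset_sum _ hx,
    Finset.prod_mul_distrib, Finset.prod_const, ← Real.exp_sum, integral_const_mul,
    Set.ncard_eq_toFinset_card _ hx, Real.exp_sub, Real.exp_sub]
  ring

lemma marginalDensity_eq (hx : (x ∩ W).Finite) (prior : Param I → ℝ) :
    marginalDensity θ W zl prior x
      = Real.exp (volume.real W) * θ ^ (x ∩ W).ncard * marginalLik θ W zl prior x := by
  unfold marginalDensity marginalLik
  rw [← integral_const_mul]
  congr 1 with β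
  rw [poissonDensity_eq hx, mul_assoc]

lemma log_marginalDensity (hθ : 0 < θ) (hx : (x ∩ W).Finite) {prior : Param I → ℝ}
    (hpos : 0 < marginalLik θ W zl prior x) :
    Real.log (marginalDensity θ W zl prior x)
      = volume.real W + ((x ∩ W).ncard : ℝ) * Real.log θ
        + Real.log (marginalLik θ W zl prior x) := by
  rw [marginalDensity_eq hx, Real.log_mul (by positivity) hpos.ne',
    Real.log_mul (Real.exp_pos _).ne' (by positivity), Real.log_exp, Real.log_pow]

lemma marginalLik_eq (hθ : 0 ≤ θ) (hW : volume W ≠ ⊤) (hz : Measurable zl)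
    (hM : ∀ u, ‖zl u‖ ≤ M) (hx : (x ∩ W).Finite) (prior : Param I → ℝ)
    (hb : score θ W zl x b = 0) :
    marginalLik θ W zl prior x
      = Real.exp (logLik θ W zl x b)
        * ∫ h, Real.exp (-tiltedIntegral (windowMeasure θ W) zl b expRem h) * prior (b + h) := by
  unfold marginalLik
  rw [← integral_add_left_eq_self _ b, ← integral_const_mul]
  congr 1 with h
  rw [logLik_add hθ hW hz hM hx, hb, inner_zero_right, add_zero, sub_eq_add_neg, Real.exp_add,
    mul_assoc]

lemma laplaceTerms_eq {prior : Param I → ℝ} {μ : ℝ} (hμ : 0 < μ)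
    (hS : (sensitivity θ W zl b).PosDef) (hprior : 0 < prior b) :
    laplaceTerms θ W zl prior μ x b = logLik θ W zl x b
      + Real.log (prior b * ∫ h : Param I,
          Real.exp (-(h.ofLp ⬝ᵥ (sensitivity θ W zl b).mulVec h.ofLp / 2))) := by
  have hdet := hS.det_pos
  have hcard : (Fintype.card (Option I) : ℝ) = (I.card : ℝ) + 1 := by simp
  rw [integral_exp_neg_half_quadForm hS, Real.log_mul hprior.ne' (by positivity),
    Real.log_mul (by positivity) (by positivity), Real.log_rpow (by positivity), Real.log_inv,
    Real.log_sqrt hdet.le, hcard]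
  unfold laplaceTerms
  rw [Matrix.det_smul, Real.log_mul (by positivity) hdet.ne', Real.log_pow, Real.log_inv, hcard]
  ring

end Marginal

section Asymptotics

lemma exists_eventually_abs_sub_le_of_locallyLipschitz {V : Type*} [NormedAddCommGroup V]
    [ProperSpace V] {f : V → ℝ} (hf : LocallyLipschitz f) (v₀ : V) :
    ∃ K, 0 ≤ K ∧ ∀ᶠ b in 𝓝 v₀, ∀ v, ‖v‖ ≤ 1 → |f (b + v) - f b| ≤ K * ‖v‖ := by
  obtain ⟨K, hK⟩ := hf.locallyLipschitzOn.exists_lipschitzOnWith_of_compact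
    (isCompact_closedBall v₀ 2)
  refine ⟨K, K.2, ?_⟩
  filter_upwards [Metric.closedBall_mem_nhds v₀ one_pos] with b hb v hv
  rw [mem_closedBall_iff_norm] at hb
  have hbv : ‖b + v - v₀‖ ≤ 2 := by
    rw [add_sub_right_comm]
    linarith [norm_add_le (b - v₀) v]
  simpa only [Real.norm_eq_abs, add_sub_cancel_left] using
    hK.norm_sub_le (mem_closedBall_iff_norm.2 hbv)
      (mem_closedBall_iff_norm.2 (hb.trans one_le_two))

lemma isBigO_inv_sqrt_rpow_neg_half {α : Type*} {l : Filter α} {μ τ : α → ℝ} (h : μ =O[l] τ)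
    (hμ : ∀ᶠ n in l, 0 < μ n) (hτ : ∀ᶠ n in l, 0 < τ n) :
    (fun n => (√(τ n))⁻¹) =O[l] fun n => (μ n) ^ (-(1 / 2) : ℝ) := by
  have hsqrt : (fun n => μ n ^ (1 / 2 : ℝ)) =O[l] fun n => τ n ^ (1 / 2 : ℝ) :=
    h.rpow (by norm_num) (hτ.mono fun n hn => hn.le)
  have hinv := hsqrt.inv_rev (hμ.mono fun n hn h0 => absurd h0 (by positivity))
  refine hinv.congr' (Eventually.of_forall fun n => ?_) ?_
  · simp only [Real.sqrt_eq_rpow]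
  · filter_upwards [hμ] with n hn
    rw [Real.rpow_neg hn.le]

variable {d p : ℕ} {I : Finset (Fin p)} {zl : Space d → Param I}

/-- The conditions under which the log-likelihood of the sample `x ∩ W` is strictly concave, with
nondegeneracy constants `c` and `κ`. -/
structure IsRegularSample (θ : ℝ) (W : Set (Space d)) (zl : Space d → Param I) (x : Set (Space d))
    (c κ : ℝ) : Prop where
  scale_pos : 0 < θ
  volume_pos : 0 < volume.real W
  finite : (x ∩ W).Finite
  isNondegenerate : IsNondegenerate (windowMeasure θ W) zl c κ

section Sample

variable {θ : ℝ} {W : Set (Space d)} {x : Set (Space d)} {b b' : Param I} {c κ M R : ℝ}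

lemma IsRegularSample.volume_ne_top (h : IsRegularSample θ W zl x c κ) : volume W ≠ ⊤ :=
  (ENNReal.toReal_pos_iff.1 h.volume_pos).2.ne

lemma isRegularSample_of_mul_pos (hτ : 0 < θ * volume.real W) (hx : (x ∩ W).Finite)
    (hB : ∀ φ : Param I, ‖φ‖ = 1 → ∃ B ⊆ W, MeasurableSet B ∧
      κ * volume.real W ≤ volume.real B ∧ ∀ u ∈ B, c ≤ |inner ℝ φ (zl u)|) :
    IsRegularSample θ W zl x c κ := by
  have hθ : 0 < θ := pos_of_mul_pos_left hτ measureReal_nonneg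
  have hvol : 0 < volume.real W := pos_of_mul_pos_right hτ hθ.le
  exact ⟨hθ, hvol, hx,
    isNondegenerate_windowMeasure hθ.le (ENNReal.toReal_pos_iff.1 hvol).2.ne hB⟩

lemma IsRegularSample.hasHuberGap (h : IsRegularSample θ W zl x c κ) (hz : Measurable zl)
    (hM : ∀ u, ‖zl u‖ ≤ M) (hc : 0 ≤ c) (hκ : 0 ≤ κ) (hb : ‖b‖ ≤ R) :
    HasHuberGap (logLik θ W zl x) b (score θ W zl x b) (θ * volume.real W * gapRate c κ M R) :=
  hasHuberGap_logLik h.scale_pos.le h.volume_ne_top hz hM h.finite hc hκ h.isNondegenerate hb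

lemma IsRegularSample.score_eq_zero (h : IsRegularSample θ W zl x c κ) (hz : Measurable zl)
    (hM : ∀ u, ‖zl u‖ ≤ M) (hb : IsArgmax (logLik θ W zl x) b) : score θ W zl x b = 0 :=
  hb.eq_zero_of_hasGradientAt
    (hasGradientAt_logLik h.scale_pos.le h.volume_ne_top hz hM h.finite b)

lemma IsRegularSample.isArgmax_unique (h : IsRegularSample θ W zl x c κ) (hz : Measurable zl)
    (hM : ∀ u, ‖zl u‖ ≤ M) (hc : 0 < c) (hκ : 0 < κ) (hb : IsArgmax (logLik θ W zl x) b)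
    (hb' : IsArgmax (logLik θ W zl x) b') : b' = b := by
  have hgap := h.hasHuberGap hz hM hc.le hκ.le (le_refl ‖b‖)
  rw [h.score_eq_zero hz hM hb] at hgap
  exact hb'.eq_of_hasHuberGap hgap
    (mul_pos (mul_pos h.scale_pos h.volume_pos) (gapRate_pos hc hκ M ‖b‖))

end Sample

variable {α : Type*} {l : Filter α} {W : α → Set (Space d)} {θ : α → ℝ}
  {x : α → Set (Space d)} {b βhat : α → Param I} {βlim : Param I} {c κ M : ℝ}

lemma eventually_isArgmax_and_tendsto (hz : Measurable zl) (hM : ∀ u, ‖zl u‖ ≤ M) (hc : 0 < c)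
    (hκ : 0 < κ) (hreg : ∀ᶠ n in l, IsRegularSample (θ n) (W n) zl (x n) c κ)
    (hb : Tendsto b l (𝓝 βlim))
    (hscore : Tendsto (fun n => (θ n * volume.real (W n))⁻¹ • score (θ n) (W n) zl (x n) (b n))
      l (𝓝 0))
    (hβhat : ∀ n, (∃ m, IsArgmax (logLik (θ n) (W n) zl (x n)) m) →
      IsArgmax (logLik (θ n) (W n) zl (x n)) (βhat n)) :
    (∀ᶠ n in l, IsArgmax (logLik (θ n) (W n) zl (x n)) (βhat n)) ∧ Tendsto βhat l (𝓝 βlim) := by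
  obtain ⟨hargmax, hsub⟩ := eventually_isArgmax_and_tendsto_sub
    (t := fun n => θ n * volume.real (W n)) (F := fun n => logLik (θ n) (W n) zl (x n))
    (gapRate_pos hc hκ M (‖βlim‖ + 1))
    (hreg.mono fun n hn => mul_pos hn.scale_pos hn.volume_pos)
    (hreg.mono fun n hn => continuous_logLik hn.scale_pos.le hn.volume_ne_top hz hM hn.finite)
    (by
      filter_upwards [hreg, hb.norm.eventually (gt_mem_nhds (lt_add_one _))] with n hn hbn
      exact hn.hasHuberGap hz hM hc.le hκ.le hbn.le)
    hscore (Eventually.of_forall hβhat)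
  exact ⟨hargmax, by simpa only [sub_add_cancel, zero_add] using hsub.add hb⟩

variable {prior : Param I → ℝ} {μ : α → ℝ}

lemma eventually_marginalLik_pos_and_isBigO_log_sub_laplaceTerms (hz : Measurable zl)
    (hM0 : 0 < M) (hM : ∀ u, ‖zl u‖ ≤ M) (hc : 0 < c) (hκ : 0 < κ)
    (hreg : ∀ᶠ n in l, IsRegularSample (θ n) (W n) zl (x n) c κ)
    (hτ : Tendsto (fun n => θ n * volume.real (W n)) l atTop)
    (hargmax : ∀ᶠ n in l, IsArgmax (logLik (θ n) (W n) zl (x n)) (βhat n))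
    (hβhat : Tendsto βhat l (𝓝 βlim)) (hprior : ∀ β, 0 ≤ prior β) (hpriori : Integrable prior)
    (hpriorL : LocallyLipschitz prior) (hpos : 0 < prior βlim) (hμ : ∀ᶠ n in l, 0 < μ n) :
    (∀ᶠ n in l, 0 < marginalLik (θ n) (W n) zl prior (x n)) ∧
      (fun n => Real.log (marginalLik (θ n) (W n) zl prior (x n))
        - laplaceTerms (θ n) (W n) zl prior (μ n) (x n) (βhat n))
        =O[l] fun n => (√(θ n * volume.real (W n)))⁻¹ := by
  obtain ⟨K, hK0, hK⟩ := exists_eventually_abs_sub_le_of_locallyLipschitz hpriorL βlim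
  have hlim : Tendsto (fun n => prior (βhat n)) l (𝓝 (prior βlim)) :=
    (hpriorL.continuous.tendsto βlim).comp hβhat
  have hphase : ∀ᶠ n in l, IsLaplacePhase (θ n * volume.real (W n))
      (gapRate c κ M (‖βlim‖ + 1)) (Real.exp ((‖βlim‖ + 1) * M) * M ^ 2 / 2)
      (Real.exp ((‖βlim‖ + 1) * M) * (M ^ 3 * Real.exp M))
      (tiltedIntegral (windowMeasure (θ n) (W n)) zl (βhat n) expRem)
      (fun h => tiltedIntegral (windowMeasure (θ n) (W n)) zl (βhat n) (· ^ 2) h / 2) := by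
    filter_upwards [hreg, hβhat.norm.eventually (gt_mem_nhds (lt_add_one _))] with n hn hbn
    have := isFiniteMeasure_windowMeasure (θ := θ n) hn.volume_ne_top
    rw [← windowMeasure_real_univ hn.scale_pos.le]
    exact isLaplacePhase_tiltedIntegral hc.le hκ.le hn.isNondegenerate hz.aestronglyMeasurable
      hM hM0.le hbn.le
  obtain ⟨hJ, hlog⟩ := laplace_method hτ (gapRate_pos hc hκ M _) (by positivity) (by positivity)
    hK0 hphase hprior hpriori (hβhat.eventually hK) hpos hlim
  have hmarginal : ∀ᶠ n in l, marginalLik (θ n) (W n) zl prior (x n)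
      = Real.exp (logLik (θ n) (W n) zl (x n) (βhat n))
        * ∫ h, Real.exp (-tiltedIntegral (windowMeasure (θ n) (W n)) zl (βhat n) expRem h)
          * prior (βhat n + h) := by
    filter_upwards [hreg, hargmax] with n hn hmax
    exact marginalLik_eq hn.scale_pos.le hn.volume_ne_top hz hM hn.finite prior
      (hn.score_eq_zero hz hM hmax)
  refine ⟨?_, hlog.congr' ?_ .rfl⟩
  · filter_upwards [hmarginal, hJ] with n hn hJn
    rw [hn]
    positivity
  · filter_upwards [hmarginal, hJ, hreg, hμ, hlim.eventually (lt_mem_nhds hpos)]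
      with n hn hJn hregn hμn hpn
    have hS := posDef_sensitivity hregn.scale_pos hregn.volume_pos hz hM hc hκ
      hregn.isNondegenerate (βhat n)
    rw [hn, Real.log_mul (Real.exp_pos _).ne' hJn.ne', Real.log_exp, laplaceTerms_eq hμn hS hpn,
      add_sub_add_left_eq_sub]
    simp only [dotProduct_sensitivity_mulVec hregn.scale_pos.le hregn.volume_ne_top hz hM]

end Asymptotics

end PointProcessBIC

theorem proposition2_general
    {Ω : Type*} [MeasurableSpace Ω] (P : Measure Ω) {d p : ℕ}
    (X : ℕ → Ω → Set (PointProcessBIC.Space d))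
    (hX : ∀ n, PointProcessBIC.IsPointProcess P (X n))
    (W : ℕ → Set (PointProcessBIC.Space d)) (hW : ∀ n, Bornology.IsBounded (W n)) (θ : ℕ → ℝ)
    {I : Finset (Fin p)} (zl : PointProcessBIC.Space d → PointProcessBIC.Param I)
    (hzl : Measurable zl) (hzl_bdd : ∃ M : ℝ, ∀ u, ‖zl u‖ ≤ M)
    (b : ℕ → PointProcessBIC.Param I) (βhat : ℕ → Ω → PointProcessBIC.Param I)
    (hβhat : ∀ n ω,
      (∃ b, PointProcessBIC.IsArgmax (PointProcessBIC.logLik (θ n) (W n) zl (X n ω)) b) →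
      PointProcessBIC.IsArgmax (PointProcessBIC.logLik (θ n) (W n) zl (X n ω)) (βhat n ω))
    (prior : PointProcessBIC.Param I → ℝ)
    (τ : ℕ → ℝ) (hτ : ∀ n, τ n = θ n * volume.real (W n))
    (μ : ℕ → ℝ) (hμ : ∀ n, μ n = PointProcessBIC.meanCount P (X n) (W n))
    (βlim : PointProcessBIC.Param I) (hb : Tendsto b atTop (𝓝 βlim))
    (hτ_top : Tendsto τ atTop atTop)
    (hscore : ∀ᵐ ω ∂P, Tendsto
      (fun n => (τ n)⁻¹ • PointProcessBIC.score (θ n) (W n) zl (X n ω) (b n)) atTop (𝓝 0))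
    (hB : ∃ c κ : ℝ, 0 < c ∧ 0 < κ ∧ ∀ᶠ n in atTop,
      ∀ φ : PointProcessBIC.Param I, ‖φ‖ = 1 → ∃ B ⊆ W n, MeasurableSet B ∧
        κ * volume.real (W n) ≤ volume.real B ∧ ∀ u ∈ B, c ≤ |inner ℝ φ (zl u)|)
    (hprior : ∀ β, 0 ≤ prior β) (hprior_int : Integrable prior)
    (hprior_lip : LocallyLipschitz prior) (hprior_pos : 0 < prior βlim)
    (hμτ : μ =Θ[atTop] τ) :
    ∀ᵐ ω ∂P,
      (∀ᶠ n in atTop,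
        PointProcessBIC.IsArgmax (PointProcessBIC.logLik (θ n) (W n) zl (X n ω)) (βhat n ω) ∧
        ∀ b, PointProcessBIC.IsArgmax (PointProcessBIC.logLik (θ n) (W n) zl (X n ω)) b →
          b = βhat n ω) ∧
      ((fun n => Real.log (PointProcessBIC.marginalLik (θ n) (W n) zl prior (X n ω))
          - PointProcessBIC.laplaceTerms (θ n) (W n) zl prior (μ n) (X n ω) (βhat n ω))
        =O[atTop] fun n => (μ n) ^ (-(1 / 2) : ℝ)) ∧
      ((fun n => Real.log (PointProcessBIC.marginalDensity (θ n) (W n) zl prior (X n ω))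
          - (volume.real (W n) + ((X n ω ∩ W n).ncard : ℝ) * Real.log (θ n)
            + PointProcessBIC.laplaceTerms (θ n) (W n) zl prior (μ n) (X n ω) (βhat n ω)))
        =O[atTop] fun n => (μ n) ^ (-(1 / 2) : ℝ)) := by
  obtain ⟨M₀, hM₀⟩ := hzl_bdd
  obtain ⟨M, hMpos, hM⟩ : ∃ M : ℝ, 0 < M ∧ ∀ u, ‖zl u‖ ≤ M :=
    ⟨max M₀ 1, by positivity, fun u => (hM₀ u).trans (le_max_left _ _)⟩
  obtain ⟨c, κ, hc, hκ, hB⟩ := hB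
  obtain rfl : τ = fun n => θ n * volume.real (W n) := funext hτ
  have hτpos := hτ_top.eventually_gt_atTop 0
  have hμpos : ∀ᶠ n in atTop, 0 < μ n := by
    filter_upwards [hμτ.isBigO_symm.eq_zero_imp, hτpos] with n hn hτn
    exact (hμ n ▸ integral_nonneg fun ω => Nat.cast_nonneg _ : 0 ≤ μ n).lt_of_ne'
      fun h0 => hτn.ne' (hn h0)
  have hfin : ∀ᵐ ω ∂P, ∀ n, (X n ω ∩ W n).Finite :=
    ae_all_iff.2 fun n => (hX n).locallyFinite.mono fun ω hω => hω _ (hW n)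
  filter_upwards [hscore, hfin] with ω hscoreω hx
  have hreg : ∀ᶠ n in atTop, PointProcessBIC.IsRegularSample (θ n) (W n) zl (X n ω) c κ := by
    filter_upwards [hτpos, hB] with n hτn hBn
    exact PointProcessBIC.isRegularSample_of_mul_pos hτn (hx n) hBn
  obtain ⟨hmax, hlim⟩ := PointProcessBIC.eventually_isArgmax_and_tendsto hzl hM hc hκ hreg hb
    hscoreω fun n => hβhat n ω
  obtain ⟨hpos, hlog⟩ :=
    PointProcessBIC.eventually_marginalLik_pos_and_isBigO_log_sub_laplaceTerms hzl hMpos hM hc hκ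
      hreg hτ_top hmax hlim hprior hprior_int hprior_lip hprior_pos hμpos
  have hrate := hlog.trans (PointProcessBIC.isBigO_inv_sqrt_rpow_neg_half hμτ.isBigO hμpos hτpos)
  refine ⟨?_, hrate, hrate.congr' ?_ .rfl⟩
  · filter_upwards [hreg, hmax] with n hn hmaxn
    exact ⟨hmaxn, fun b' hb' => hn.isArgmax_unique hzl hM hc hκ hmaxn hb'⟩
  · filter_upwards [hreg, hpos] with n hn hposn
    rw [PointProcessBIC.log_marginalDensity hn.scale_pos hn.finite hposn]
    ring

theorem proposition2
    {Ω : Type*} [MeasurableSpace Ω] (P : Measure Ω) [IsProbabilityMeasure P]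
    {d p : ℕ}
    -- the point processes, the observation windows and the known scale factors
    (X : ℕ → Ω → Set (PointProcessBIC.Space d))
    (hX : ∀ n, PointProcessBIC.IsPointProcess P (X n))
    (W : ℕ → Set (PointProcessBIC.Space d)) (θ : ℕ → ℝ)
    -- the covariates and the model
    (z : Fin p → PointProcessBIC.Space d → ℝ) (I : Finset (Fin p))
    (zl : PointProcessBIC.Space d → PointProcessBIC.Param I)
    (hzl : zl = PointProcessBIC.covVec z I)
    -- the least wrong parameter values, defined for large `n`
    (βstar : ℕ → PointProcessBIC.Param I)
    (hβstar : ∀ᶠ n in atTop, PointProcessBIC.IsArgmax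
      (fun β => ∫ ω, PointProcessBIC.logLik (θ n) (W n) zl (X n ω) β ∂P) (βstar n))
    -- the estimator: a maximizer of the likelihood whenever there is one
    (βhat : ℕ → Ω → PointProcessBIC.Param I)
    (hβhat : ∀ n ω,
      (∃ b, PointProcessBIC.IsArgmax (PointProcessBIC.logLik (θ n) (W n) zl (X n ω)) b) →
      PointProcessBIC.IsArgmax (PointProcessBIC.logLik (θ n) (W n) zl (X n ω)) (βhat n ω))
    (prior : PointProcessBIC.Param I → ℝ)
    (τ : ℕ → ℝ) (hτ : ∀ n, τ n = θ n * volume.real (W n))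
    (μ : ℕ → ℝ) (hμ : ∀ n, μ n = PointProcessBIC.meanCount P (X n) (W n))
    -- (C1') the least wrong parameter values converge
    (βlim : PointProcessBIC.Param I) (hC1 : Tendsto βstar atTop (𝓝 βlim))
    -- (C2) continuous covariates, with norm bounded and bounded away from zero
    (hC2_cont : Continuous zl)
    (hC2_bdd : ∃ m M : ℝ, 0 < m ∧ ∀ u, m ≤ ‖zl u‖ ∧ ‖zl u‖ ≤ M)
    -- (C3) the double asymptotic framework
    (hC3_mono : Monotone τ) (hC3_θ : ∃ a : ℝ, 0 < a ∧ ∀ᶠ n in atTop, a ≤ θ n)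
    (hC3_τ : Tendsto τ atTop atTop)
    (hC3_W : ∀ n, Convex ℝ (W n) ∧ IsCompact (W n))
    -- (C4) law of large numbers for the score
    (hC4 : ∀ᵐ ω ∂P, Tendsto
      (fun n => (τ n)⁻¹ • PointProcessBIC.score (θ n) (W n) zl (X n ω) (βstar n)) atTop (𝓝 0))
    -- (C5) nondegeneracy of the covariates
    (hC5_pos : ∀ n β, (PointProcessBIC.sensitivity (θ n) (W n) zl β).PosDef)
    (hC5_B : ∃ c κ : ℝ, 0 < c ∧ 0 < κ ∧ ∀ᶠ n in atTop,
      ∀ φ : PointProcessBIC.Param I, ‖φ‖ = 1 → ∃ B ⊆ W n, MeasurableSet B ∧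
        κ * volume.real (W n) ≤ volume.real B ∧ ∀ u ∈ B, c ≤ |inner ℝ φ (zl u)|)
    -- (C8) a continuously differentiable prior probability density, positive at the limit
    (hC8_nonneg : ∀ β, 0 ≤ prior β) (hC8_int : ∫ β, prior β = 1)
    (hC8_diff : ContDiff ℝ 1 prior) (hC8_pos : 0 < prior βlim)
    -- (C9) the mean number of points has the order of `τ`
    (hC9 : μ =Θ[atTop] τ) :
    ∀ᵐ ω ∂P,
      (∀ᶠ n in atTop,
        PointProcessBIC.IsArgmax (PointProcessBIC.logLik (θ n) (W n) zl (X n ω)) (βhat n ω) ∧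
        ∀ b, PointProcessBIC.IsArgmax (PointProcessBIC.logLik (θ n) (W n) zl (X n ω)) b →
          b = βhat n ω) ∧
      ((fun n => Real.log (PointProcessBIC.marginalLik (θ n) (W n) zl prior (X n ω))
          - PointProcessBIC.laplaceTerms (θ n) (W n) zl prior (μ n) (X n ω) (βhat n ω))
        =O[atTop] fun n => (μ n) ^ (-(1 / 2) : ℝ)) ∧
      ((fun n => Real.log (PointProcessBIC.marginalDensity (θ n) (W n) zl prior (X n ω))
          - (volume.real (W n) + ((X n ω ∩ W n).ncard : ℝ) * Real.log (θ n)
            + PointProcessBIC.laplaceTerms (θ n) (W n) zl prior (μ n) (X n ω) (βhat n ω)))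
        =O[atTop] fun n => (μ n) ^ (-(1 / 2) : ℝ)) := by
  exact proposition2_general P X hX W (fun n => (hC3_W n).2.isBounded) θ zl hC2_cont.measurable
    (let ⟨_, M, _, hM⟩ := hC2_bdd; ⟨M, fun u => (hM u).2⟩) βstar βhat hβhat prior τ hτ μ hμ βlim
    hC1 hC3_τ hC4 hC5_B hC8_nonneg (.of_integral_ne_zero (hC8_int ▸ one_ne_zero))
    hC8_diff.locallyLipschitz hC8_pos hC9
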